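/- **Setting.** Let $m,r\ge 2$ be integers, $c\in\mathbb C$, $k\in\mathbb C\setminus\{0\}$ with $1/k\notin\mathbb Z$; fix a square root $\sqrt k$ and put $\alpha=1/\sqrt k$. Fix constants $\varepsilon\in\{1,-1\}$ and $\kappa\in\mathbb C$ with $\kappa=\tfrac12$ or $2\kappa^2=1$ or $2\kappa^2=-1$ (the theorem holds for each of these normalisations). *Algebra.* Let $p(t)=1-2ct^r+t^{2r}$, $A=\mathbb C[t^{\pm1},u]/(u^m-p(t))$, and $\widetilde G=(\mathfrak{sl}_2\otimes A)\oplus\Omega^1_{A/\mathbb C}/dA$ with bracket $[x\otimes f,y\otimes g]=[x,y]\otimes fg+(x|y)\,\overline{f\,dg}$, the second summand being central, where $(x|y)=\operatorname{tr}(xy)$. Let $e,h,f$ be the standard basis of $\mathfrak{sl}_2$. *Fock space.* For $l=0,\dots,m-1$ take operators $\beta^{(l)}_n,\gamma^{(l)}_n$ ($n\in\mathbb Z$) and $b^{(l)}_n$ ($n\in\mathbb Z\setminus\{0\}$) with $[\gamma^{(l)}_p,\beta^{(l')}_q]=\varepsilon\,\delta_{l,l'}\delta_{p+q,0}$, $[b^{(l)}_p,b^{(l')}_q]=2p\,\delta_{l,l'}\delta_{p+q,0}$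 and all other commutators zero. Let $\mathcal F$ be the Fock space with vacuum annihilated by $\beta^{(l)}_n$, $b^{(l)}_n$ ($n\ge1$) and $\gamma^{(l)}_n$ ($n\ge0$). Put $\beta^{(l)}(z)=\sum\beta^{(l)}_nz^{-n-1}$, $\gamma^{(l)}(z)=\sum\gamma^{(l)}_nz^{-n}$, $b^{(l)}(z)=\sum_{n\ne0} b^{(l)}_nz^{-n-1}$, and $\phi(z)=\kappa\sum_{n\ne0}b^{(0)}_n z^{-n}/(-n)$, so that $\partial\phi=\kappa\, b^{(0)}$. Normal ordering $:\ :$ puts annihilation operators to the right. For $l\ne0$ let $$e^{(0)}=\beta^{(0)},\qquad h^{(0)}=-2:\!\beta^{(0)}\gamma^{(0)}\!:+\sqrt k\,b^{(0)},\qquad f^{(0)}=-:\!\beta^{(0)}(\gamma^{(0)})^2\!:+(k+2)\,\partial\gamma^{(0)}+\sqrt k\,b^{(0)}\gamma^{(0)},$$ $$e^{(l)}=\beta^{(l)}:\!e^{\alpha\phi}\!:,\qquad h^{(l)}=-:\!\beta^{(l)}\gamma^{(0)}\!:-:\!\beta^{(0)}\gamma^{(l)}\!:+\tfrac{\sqrt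 k}{2}b^{(l)},$$ $$f^{(l)}=\Bigl[-:\!\beta^{(0)}\gamma^{(l)}\gamma^{(0)}\!:+\tfrac{k+2}{k}\,\partial\gamma^{(l)}+\tfrac{\sqrt k}{2}b^{(l)}\gamma^{(l)}\Bigr]:\!e^{-\alpha\phi}\!:+\tfrac1{\sqrt k}\,b^{(0)}\gamma^{(l)}.$$ *OPEs.* A field is a series $a(z)=\sum_{n\in\mathbb Z} a_nz^n$, $a_n\in\operatorname{End}\mathcal F$, such that $a(z)v$ has finitely many negative powers for every $v\in\mathcal F$. For a series $S(z,w)$ write $a(z)b(w)\sim S(z,w)$ if $(a(z)b(w)-S(z,w))v\in\mathcal F((z,w))$ (powers of both $z$ and $w$ bounded below) for every $v\in\mathcal F$. The product $a(z)b(w)$ is a *Laurent series in $z-w$* if $a(z)b(w)\sim\sum_{j=0}^{N-1}C_j(w)(z-w)^{-j-1}$ (expanded in $|z|>|w|$) for some $N$ and some fields $C_j$; it has *residue* $R(w)$ if this holds with $N\ge1$ and $C_0=R$. *Wakimoto-type class.* A raising field of sector $l$ is $:\!X e^{\alpha\phi}\!:$ with $X$ a normally ordered monomial in $\beta^{(l)},\gamma^{(l)}$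 and their derivatives. A lowering field of sector $l$ is $:\!Ye^{-\alpha\phi}\!:+Z$ with $Y,Z$ linear combinations of normally ordered monomials in $\beta^{(0)},\gamma^{(0)},\beta^{(l)},\gamma^{(l)}$, the $b^{(j)}$ ($0\le j<m$), and their derivatives. The $h^{(0)}$-charge of such a monomial with $p$ factors $\beta^{(0)}$ and $q$ factors $\gamma^{(0)}$ (derivatives included) is $-2\varepsilon(p-q)$. *Realization.* A product $E(z)F(w)$ *realizes the bracket of $\widetilde G$ in the sectors $(l_1,l_2)$* if there is a linear map $\rho:\widetilde G\to\operatorname{End}\mathcal F$ with $E(z)=\sum_i\rho(e\otimes t^iu^{l_1})z^{-i-1}$, $F(w)=\sum_j\rho(f\otimes t^ju^{l_2})w^{-j-1}$, $h^{(l)}(w)=\sum_n\rho(h\otimes t^nu^l)w^{-n-1}$ for $0\le l<m$, with $\rho$ of each element of $\Omega^1_{A/\mathbb C}/dA$ a scalar, and with $$E(z)F(w)\sim\sum_{i\ge0,\ j\in\mathbb Z}\rho\bigl([e\otimes t^iu^{l_1},f\otimes t^ju^{l_2}]\bigr)z^{-i-1}w^{-j-1}.$$ **Theorem (Unified obstruction).**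 (A) For $1\le l\le m-1$, $e^{(0)}(z)f^{(l)}(w)$ does not have residue $h^{(l)}(w)$; in particular $e^{(0)}(z)f^{(l)}(w)\not\sim h^{(l)}(w)/(z-w)$. (B) For $1\le l_1,l_2\le m-1$, $e^{(l_1)}(z)f^{(l_2)}(w)$ is not a Laurent series in $z-w$. (C) For $1\le l\le m-1$, $e^{(l)}(z)f^{(m-l)}(w)$ is not a Laurent series in $z-w$. Hence no mixed-sector bracket is realized within the Wakimoto-type class. Precisely, for $1\le l,l_1,l_2\le m-1$: (D1) if $F$ is a lowering field of sector $l$ in which every monomial of $Z$ has $h^{(0)}$-charge $-2$ or $0$ (for instance $F=f^{(l)}$), then $e^{(0)}(z)F(w)$ does not realize the bracket in the sectors $(0,l)$; (D2) if $E$ is a raising field of sector $l$ (for instance $E=e^{(l)}$), then $E(z)f^{(0)}(w)$ does not realize the bracket in the sectors $(l,0)$; (D3) if $E$ is a raising field of sector $l_1$ and $F$ a lowering field of sector $l_2$, then $E(z)F(w)$ does not realize the bracket in the sectors $(l_1,l_2)$. -/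

import Mathlib

open scoped TensorProduct

noncomputable section

namespace Superelliptic

/-! ## Formal fields and operator product expansions -/

section Fields

variable (V : Type) [AddCommGroup V] [Module ℂ V]

/-- Fields on `V`: formal series `a(z) = ∑ a_n z^n` (`n ∈ ℤ`, `a_n` the coefficient of `z^n`) with
coefficients in `End V` such that `a(z) v` has only finitely many negative powers, for all `v`. -/
def QField : Submodule ℂ (ℤ → Module.End ℂ V) where
  carrier := {a | ∀ v, ∃ K : ℤ, ∀ n < K, a n v = 0}
  zero_mem' := fun _ => ⟨0, fun _ _ => rfl⟩
  add_mem' := by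
    intro a b ha hb v
    obtain ⟨K, hK⟩ := ha v
    obtain ⟨L, hL⟩ := hb v
    refine ⟨min K L, fun n hn => ?_⟩
    simp [hK n (lt_of_lt_of_le hn (min_le_left _ _)), hL n (lt_of_lt_of_le hn (min_le_right _ _))]
  smul_mem' := by
    intro c a ha v
    obtain ⟨K, hK⟩ := ha v
    exact ⟨K, fun n hn => by simp [hK n hn]⟩

variable {V}

/-- The `n`-th mode of a field written as `a(z) = ∑ a_(n) z^(-n-1)`. -/
def fieldMode (a : QField V) (n : ℤ) : Module.End ℂ V := a.1 (-n - 1)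

variable (V) in
/-- The identity field. -/
def oneField : QField V :=
  ⟨Pi.single 0 1, fun v => ⟨0, fun n hn => by simp [Pi.single_eq_of_ne hn.ne]⟩⟩

/-- The formal series `∑ P m n z^m w^n` lies in `V((z,w))`: the powers of both variables are bounded
below, so that it can be expanded in nonnegative powers of `z - w` at `z = w`. -/
def IsRegular (P : ℤ → ℤ → V) : Prop :=
  ∃ K : ℤ, ∀ m n, (m < K ∨ n < K) → P m n = 0

/-- `a(z) b(w) ∼ S(z,w)`: the difference is regular on every vector. -/
def OPE (a b : QField V) (S : ℤ → ℤ → Module.End ℂ V) : Prop :=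
  ∀ v, IsRegular fun m n => a.1 m (b.1 n v) - S m n v

/-- Coefficient of `z^m w^n` in `∑_{j < N} C_j(w) / (z - w)^(j+1)`, expanded in `|z| > |w|`, that is
with `1 / (z - w)^(j+1) = ∑_{p ≥ 0} (p choose j) z^(-p-1) w^(p-j)`. -/
def polarPart (N : ℕ) (C : ℕ → QField V) (m n : ℤ) : Module.End ℂ V :=
  if m < 0 then
    ∑ j ∈ Finset.range N, (((-m - 1).toNat.choose j : ℕ) : ℂ) • (C j).1 (n + m + 1 + j)
  else 0

/-- The product `a(z) b(w)` is a Laurent series in `z - w` (with a pole of finite order). -/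
def IsLaurentOPE (a b : QField V) : Prop :=
  ∃ (N : ℕ) (C : ℕ → QField V), OPE a b (polarPart N C)

/-- The product `a(z) b(w)` is a Laurent series in `z - w` whose coefficient of `(z - w)^(-1)` is
`R(w)`. -/
def HasResidue (a b R : QField V) : Prop :=
  ∃ (N : ℕ) (C : ℕ → QField V), 0 < N ∧ C 0 = R ∧ OPE a b (polarPart N C)

variable (V) in
/-- A free field, split into its creation and annihilation parts. -/
structure FreeField where
  cre : ℤ → Module.End ℂ V
  ann : ℤ → Module.End ℂ V
  cre_lb : ∃ K : ℤ, ∀ i < K, cre i = 0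
  ann_ub : ∃ K : ℤ, ∀ i > K, ann i = 0
  ann_lb : ∀ v, ∃ K : ℤ, ∀ i < K, ann i v = 0

/-- Derivative `∂_z` of a formal series. -/
def derivSeries (a : ℤ → Module.End ℂ V) (i : ℤ) : Module.End ℂ V := ((i + 1 : ℤ) : ℂ) • a (i + 1)

/-- Derivative of a free field. -/
def FreeField.deriv (a : FreeField V) : FreeField V where
  cre := derivSeries a.cre
  ann := derivSeries a.ann
  cre_lb := by
    obtain ⟨K, hK⟩ := a.cre_lb
    exact ⟨K - 1, fun i hi => by simp [derivSeries, hK (i + 1) (by omega)]⟩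
  ann_ub := by
    obtain ⟨K, hK⟩ := a.ann_ub
    exact ⟨K, fun i hi => by simp [derivSeries, hK (i + 1) (by omega)]⟩
  ann_lb := by
    intro v
    obtain ⟨K, hK⟩ := a.ann_lb v
    exact ⟨K - 1, fun i hi => by simp [derivSeries, hK (i + 1) (by omega)]⟩

lemma cre_support (a : FreeField V) (A : QField V) (n : ℤ) (v : V) :
    (Function.support fun i : ℤ => a.cre i (A.1 (n - i) v)).Finite := by
  obtain ⟨K, hK⟩ := a.cre_lb
  obtain ⟨L, hL⟩ := A.2 v
  refine (Set.finite_Icc K (n - L)).subset fun i hi => ?_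
  by_contra h
  apply hi
  rw [Set.mem_Icc, not_and_or, not_le, not_le] at h
  rcases h with h | h
  · simp [hK i h]
  · simp [hL (n - i) (by omega)]

lemma ann_support (a : FreeField V) (A : QField V) (n : ℤ) (v : V) :
    (Function.support fun i : ℤ => A.1 (n - i) (a.ann i v)).Finite := by
  obtain ⟨K, hK⟩ := a.ann_ub
  obtain ⟨L, hL⟩ := a.ann_lb v
  refine (Set.finite_Icc L K).subset fun i hi => ?_
  by_contra h
  apply hi
  rw [Set.mem_Icc, not_and_or, not_le, not_le] at h
  rcases h with h | h
  · simp [hL i h]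
  · simp [hK i h]

/-- The normally ordered product `:a(z) A(z): = a_cre(z) A(z) + A(z) a_ann(z)`. -/
def nprod (a : FreeField V) (A : QField V) : QField V :=
  ⟨fun n =>
    { toFun := fun v => (∑ᶠ i : ℤ, a.cre i (A.1 (n - i) v)) + ∑ᶠ i : ℤ, A.1 (n - i) (a.ann i v)
      map_add' := by
        intro x y
        simp only [map_add]
        rw [finsum_add_distrib (cre_support a A n x) (cre_support a A n y),
          finsum_add_distrib (ann_support a A n x) (ann_support a A n y)]
        abel
      map_smul' := by
        intro c x
        simp only [map_smul, RingHom.id_apply, smul_add, smul_finsum] },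
    by
      intro v
      obtain ⟨K, hK⟩ := a.cre_lb
      obtain ⟨L, hL⟩ := A.2 v
      obtain ⟨M, hM⟩ := a.ann_ub
      obtain ⟨P, hP⟩ := a.ann_lb v
      choose B hB using fun i : ℤ => A.2 (a.ann i v)
      obtain ⟨Q, hQ⟩ : ∃ Q : ℤ, ∀ i ∈ Finset.Icc P M, Q ≤ i + B i := by
        obtain ⟨Q, hQ⟩ := ((Finset.Icc P M).image fun i => i + B i).bddBelow
        exact ⟨Q, fun i hi => hQ (by simpa using ⟨i, by simpa using hi, rfl⟩)⟩
      refine ⟨min (K + L) Q, fun n hn => ?_⟩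
      have hn1 := lt_of_lt_of_le hn (min_le_left _ _)
      have hn2 := lt_of_lt_of_le hn (min_le_right _ _)
      have h1 : ∀ i : ℤ, a.cre i (A.1 (n - i) v) = 0 := by
        intro i
        by_cases h : i < K
        · simp [hK i h]
        · simp [hL (n - i) (by omega)]
      have h2 : ∀ i : ℤ, A.1 (n - i) (a.ann i v) = 0 := by
        intro i
        by_cases h : i < P
        · simp [hP i h]
        by_cases h' : i > M
        · simp [hM i h']
        · have := hQ i (by simp; omega)
          exact hB i (n - i) (by omega)
      simp [h1, h2]⟩

end Fields

/-! ## Oscillators and the Fock space -/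

/-- Creation operators: `beta l n` is `β^(l)_(-n)`, `gamma l n` is `γ^(l)_(-n-1)` and `heis l n` is
`b^(l)_(-n-1)`, for `n ≥ 0`. -/
inductive Osc (m : ℕ)
  | beta (l : Fin m) (n : ℕ)
  | gamma (l : Fin m) (n : ℕ)
  | heis (l : Fin m) (n : ℕ)
  deriving DecidableEq

/-- The Fock space: polynomials in the creation operators, with vacuum `1`. It is the tensor product
over all sectors of the Fock spaces of the single sectors. -/
abbrev Fock (m : ℕ) : Type := MvPolynomial (Osc m) ℂ

/-- The operator of multiplication by a variable. -/
def create {m : ℕ} (x : Osc m) : Module.End ℂ (Fock m) := LinearMap.mulLeft ℂ (MvPolynomial.X x)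

/-- The operator of differentiation by a variable. -/
def annih {m : ℕ} (x : Osc m) : Module.End ℂ (Fock m) := (MvPolynomial.pderiv x).toLinearMap

/-- Names of the generating fields. -/
inductive Gen (m : ℕ)
  | beta (l : Fin m)
  | gamma (l : Fin m)
  | heis (l : Fin m)
  deriving DecidableEq

/-- The modes `β^(l)_n`, `γ^(l)_n`, `b^(l)_n`, with `[γ_p, β_q] = ε δ_{p+q,0}`,
`[b_p, b_q] = 2p δ_{p+q,0}`; the vacuum is annihilated by `β_n` for `n ≥ 1` and by `γ_n`, `b_n` for
`n ≥ 0`. -/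
def mode {m : ℕ} (ε : ℂ) : Gen m → ℤ → Module.End ℂ (Fock m)
  | .beta l, n => if n ≤ 0 then create (.beta l (-n).toNat) else (-ε) • annih (.gamma l (n - 1).toNat)
  | .gamma l, n => if n < 0 then create (.gamma l (-n - 1).toNat) else ε • annih (.beta l n.toNat)
  | .heis l, n =>
      if n < 0 then create (.heis l (-n - 1).toNat)
      else if n = 0 then 0 else (2 * (n : ℂ)) • annih (.heis l (n - 1).toNat)

/-- The indices of the modes that are annihilation operators. -/
def IsAnn {m : ℕ} : Gen m → ℤ → Prop
  | .beta _, n => 1 ≤ n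
  | .gamma _, n => 0 ≤ n
  | .heis _, n => 0 ≤ n

/-- The index of the mode that multiplies `z^i`: `β(z) = ∑ β_n z^(-n-1)`, `γ(z) = ∑ γ_n z^(-n)`,
`b(z) = ∑ b_n z^(-n-1)`. -/
def modeIndex {m : ℕ} : Gen m → ℤ → ℤ
  | .beta _, i => -i - 1
  | .gamma _, i => -i
  | .heis _, i => -i - 1

lemma annih_eventually {m : ℕ} (x : ℕ → Osc m) (hx : Function.Injective x) (v : Fock m) :
    ∃ N : ℕ, ∀ n ≥ N, annih (x n) v = 0 := by
  have hfin : (x ⁻¹' (v.vars : Set (Osc m))).Finite :=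
    (Finset.finite_toSet _).preimage hx.injOn
  obtain ⟨N, hN⟩ := hfin.bddAbove
  refine ⟨N + 1, fun n hn => ?_⟩
  apply MvPolynomial.pderiv_eq_zero_of_notMem_vars
  intro h
  have := hN (show n ∈ x ⁻¹' (v.vars : Set (Osc m)) from h)
  omega

open Classical in
/-- The generating fields `β^(l)(z)`, `γ^(l)(z)`, `b^(l)(z)`. -/
def genField {m : ℕ} (ε : ℂ) (g : Gen m) : FreeField (Fock m) where
  cre i := if IsAnn g (modeIndex g i) then 0 else mode ε g (modeIndex g i)
  ann i := if IsAnn g (modeIndex g i) then mode ε g (modeIndex g i) else 0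
  cre_lb := by
    refine ⟨-1, fun i hi => if_pos ?_⟩
    cases g <;> simp only [IsAnn, modeIndex] <;> omega
  ann_ub := by
    refine ⟨0, fun i hi => if_neg ?_⟩
    cases g <;> simp only [IsAnn, modeIndex] <;> omega
  ann_lb := by
    intro v
    cases g with
    | beta l =>
      obtain ⟨N, hN⟩ := annih_eventually (Osc.gamma l) (fun a b h => by cases h; rfl) v
      refine ⟨-N - 2, fun i hi => ?_⟩
      rw [if_pos (by simp only [IsAnn, modeIndex]; omega)]
      show mode ε (.beta l) (-i - 1) v = 0
      rw [mode, if_neg (by omega), LinearMap.smul_apply, hN _ (by omega), smul_zero]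
    | gamma l =>
      obtain ⟨N, hN⟩ := annih_eventually (Osc.beta l) (fun a b h => by cases h; rfl) v
      refine ⟨-N - 2, fun i hi => ?_⟩
      rw [if_pos (by simp only [IsAnn, modeIndex]; omega)]
      show mode ε (.gamma l) (-i) v = 0
      rw [mode, if_neg (by omega), LinearMap.smul_apply, hN _ (by omega), smul_zero]
    | heis l =>
      obtain ⟨N, hN⟩ := annih_eventually (Osc.heis l) (fun a b h => by cases h; rfl) v
      refine ⟨-N - 2, fun i hi => ?_⟩
      rw [if_pos (by simp only [IsAnn, modeIndex]; omega)]
      show mode ε (.heis l) (-i - 1) v = 0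
      rw [mode, if_neg (by omega), if_neg (by omega), LinearMap.smul_apply, hN _ (by omega), smul_zero]

/-- `∂^d g(z)` for a letter `(g, d)`. -/
def letterField {m : ℕ} (ε : ℂ) (a : Gen m × ℕ) : FreeField (Fock m) :=
  FreeField.deriv^[a.2] (genField ε a.1)

/-- The normally ordered product `:∂^d₁ g₁(z) ⋯ ∂^dₛ gₛ(z) B(z):`. -/
def nord {m : ℕ} (ε : ℂ) (L : List (Gen m × ℕ)) (B : QField (Fock m)) : QField (Fock m) :=
  L.foldr (fun a A => nprod (letterField ε a) A) B

/-! ## The exponentials of the scalar field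

The scalar field is `φ(z) = κ ∑_{n ≠ 0} b^(0)_n z^(-n) / (-n)`, so that `∂φ = κ b^(0)`. -/

section Vertex

variable {m : ℕ} [NeZero m]

/-- The creation part `a φ_cre(z) = a κ ∑_{j ≥ 1} b^(0)_(-j) z^j / j` of `a φ(z)`. -/
def phiCre (κ a : ℂ) : PowerSeries (Fock m) :=
  PowerSeries.mk fun j =>
    if j = 0 then 0 else (a * κ / (j : ℂ)) • (MvPolynomial.X (Osc.heis 0 (j - 1)) : Fock m)

/-- Coefficient of `z^n` in `exp (a φ_cre(z))`. -/
def expCre (κ a : ℂ) (n : ℤ) : Fock m :=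
  if 0 ≤ n then
    ∑ p ∈ Finset.range (n.toNat + 1),
      ((p.factorial : ℂ)⁻¹) • PowerSeries.coeff n.toNat ((phiCre κ a : PowerSeries (Fock m)) ^ p)
  else 0

/-- The operator `exp (a φ_ann(z))`, as a polynomial in `y = z⁻¹`. As
`a φ_ann(z) = - a κ ∑_{j ≥ 1} b^(0)_j y^j / j = - 2 a κ ∑_{j ≥ 1} y^j ∂/∂b^(0)_(-j)`, it is the
translation of each variable `b^(0)_(-j)` by `- 2 a κ y^j`. -/
def expAnn (κ a : ℂ) : Fock m →ₐ[ℂ] Polynomial (Fock m) :=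
  MvPolynomial.aeval fun x =>
    match x with
    | .heis l n =>
        Polynomial.C (MvPolynomial.X (Osc.heis l n)) -
          (if l = 0 then (2 * a * κ) • (Polynomial.X ^ (n + 1) : Polynomial (Fock m)) else 0)
    | x => Polynomial.C (MvPolynomial.X x)

/-- The normally ordered exponential `:exp (a φ(z)): = exp (a φ_cre(z)) exp (a φ_ann(z))`. -/
def vertexExp (κ a : ℂ) : QField (Fock m) :=
  ⟨fun n =>
    (Polynomial.lsum fun i : ℕ => LinearMap.mulLeft ℂ (expCre κ a (n + i) : Fock m)) ∘ₗ
      (expAnn κ a).toLinearMap,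
    by
      intro v
      refine ⟨-((expAnn κ a v).natDegree : ℤ), fun n hn => ?_⟩
      simp only [LinearMap.comp_apply, AlgHom.toLinearMap_apply, Polynomial.lsum_apply,
        Polynomial.sum]
      refine Finset.sum_eq_zero fun i hi => ?_
      have := Polynomial.le_natDegree_of_mem_supp i hi
      simp [expCre, show ¬ (0 ≤ n + (i : ℤ)) by omega]⟩

/-! ## The vertex operators

Here `s` is a square root of the level `k = s ^ 2`, and `α = 1 / s`. -/

/-- `e^(0) = β^(0)`. -/
def eEven (m : ℕ) [NeZero m] (ε : ℂ) : QField (Fock m) := nord ε [(.beta 0, 0)] (oneField _)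

/-- `h^(0) = -2 :β^(0) γ^(0): + √k b^(0)`. -/
def hEven (m : ℕ) [NeZero m] (ε s : ℂ) : QField (Fock m) :=
  (-2 : ℂ) • nord ε [(.beta 0, 0), (.gamma 0, 0)] (oneField _) +
    s • nord ε [(.heis 0, 0)] (oneField _)

/-- `f^(0) = -:β^(0) γ^(0) γ^(0): + (k + 2) ∂γ^(0) + √k b^(0) γ^(0)`. -/
def fEven (m : ℕ) [NeZero m] (ε s : ℂ) : QField (Fock m) :=
  -nord ε [(.beta 0, 0), (.gamma 0, 0), (.gamma 0, 0)] (oneField _) +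
    (s ^ 2 + 2) • nord ε [(.gamma 0, 1)] (oneField _) +
    s • nord ε [(.heis 0, 0), (.gamma 0, 0)] (oneField _)

/-- `e^(l) = β^(l) :exp (α φ):`, for `l ≠ 0`. -/
def eOdd (ε κ s : ℂ) (l : Fin m) : QField (Fock m) := nord ε [(.beta l, 0)] (vertexExp κ s⁻¹)

/-- `h^(l) = -:β^(l) γ^(0): - :β^(0) γ^(l): + (√k / 2) b^(l)`, for `l ≠ 0`. -/
def hOdd (ε s : ℂ) (l : Fin m) : QField (Fock m) :=
  -nord ε [(.beta l, 0), (.gamma 0, 0)] (oneField _) -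
    nord ε [(.beta 0, 0), (.gamma l, 0)] (oneField _) +
    (s / 2) • nord ε [(.heis l, 0)] (oneField _)

/-- `f^(l) = [-:β^(0) γ^(l) γ^(0): + ((k + 2) / k) ∂γ^(l) + (√k / 2) b^(l) γ^(l)] :exp (-α φ):
+ (1 / √k) b^(0) γ^(l)`, for `l ≠ 0`. -/
def fOdd (ε κ s : ℂ) (l : Fin m) : QField (Fock m) :=
  -nord ε [(.beta 0, 0), (.gamma l, 0), (.gamma 0, 0)] (vertexExp κ (-s⁻¹)) +
    ((s ^ 2 + 2) / s ^ 2) • nord ε [(.gamma l, 1)] (vertexExp κ (-s⁻¹)) +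
    (s / 2) • nord ε [(.heis l, 0), (.gamma l, 0)] (vertexExp κ (-s⁻¹)) +
    s⁻¹ • nord ε [(.heis 0, 0), (.gamma l, 0)] (oneField _)

/-- `h^(l)` for every sector `l`. -/
def hField (ε s : ℂ) (l : Fin m) : QField (Fock m) := if l = 0 then hEven m ε s else hOdd ε s l

/-! ## The Wakimoto-type class -/

/-- `E(z) = :X(z) exp (a φ(z)):` with `X` a normally ordered monomial in `β^(l)`, `γ^(l)` and their
derivatives. -/
def IsWakimotoRaising (ε κ a : ℂ) (l : Fin m) (E : QField (Fock m)) : Prop :=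
  ∃ L : List (Gen m × ℕ), (∀ x ∈ L, x.1 = .beta l ∨ x.1 = .gamma l) ∧ E = nord ε L (vertexExp κ a)

/-- The monomials in the ghost fields of the sectors `0` and `l`, the Heisenberg fields, and their
derivatives. -/
def lowerMonomials (l : Fin m) : Set (List (Gen m × ℕ)) :=
  {L | ∀ x ∈ L, x.1 = .beta 0 ∨ x.1 = .gamma 0 ∨ x.1 = .beta l ∨ x.1 = .gamma l ∨
    ∃ j, x.1 = .heis j}

/-- The `h^(0)`-charge of a normally ordered monomial without exponential: `h^(0)` contains
`-2 :β^(0) γ^(0):` and `γ(z) β(w) ∼ ε / (z - w)`, so `β^(0)` has charge `-2 ε`, `γ^(0)` has charge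
`2 ε`, and all the other generating fields have charge `0`. -/
def charge (ε : ℂ) (L : List (Gen m × ℕ)) : ℂ :=
  -2 * ε * (((L.countP fun x => decide (x.1 = .beta 0) : ℕ) : ℂ) -
    ((L.countP fun x => decide (x.1 = .gamma 0) : ℕ) : ℂ))

/-- `F(w) = :Y(w) exp (-a φ(w)): + Z(w)` with `Y` a linear combination of monomials in
`lowerMonomials l`, and `Z` a linear combination of those that also satisfy `P`. -/
def IsWakimotoLowering (ε κ a : ℂ) (l : Fin m) (P : List (Gen m × ℕ) → Prop)
    (F : QField (Fock m)) : Prop :=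
  ∃ Y Z : QField (Fock m),
    Y ∈ Submodule.span ℂ ((fun L => nord ε L (vertexExp κ (-a))) '' lowerMonomials l) ∧
    Z ∈ Submodule.span ℂ ((fun L => nord ε L (oneField _)) '' {L ∈ lowerMonomials l | P L}) ∧
    F = Y + Z

end Vertex

/-! ## The superelliptic algebra and its central extension -/

section Algebra

/-- `p(t) = 1 - 2 c t^r + t^(2r)`. -/
def pPoly (r : ℕ) (c : ℂ) : LaurentPolynomial ℂ :=
  1 - (2 * c) • LaurentPolynomial.T (r : ℤ) + LaurentPolynomial.T (2 * r : ℤ)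

/-- The ring `A = ℂ[t, t⁻¹, u] / (u^m - p(t))`. -/
abbrev superRing (m r : ℕ) (c : ℂ) : Type :=
  AdjoinRoot ((Polynomial.X : Polynomial (LaurentPolynomial ℂ)) ^ m - Polynomial.C (pPoly r c))

/-- The element `t^i u^l` of `A`. -/
def tu (m r : ℕ) (c : ℂ) (i : ℤ) (l : ℕ) : superRing m r c :=
  AdjoinRoot.of _ (LaurentPolynomial.T i) * AdjoinRoot.root _ ^ l

/-- The centre `Ω¹_{A/ℂ} / dA`. -/
abbrev centre (m r : ℕ) (c : ℂ) : Type :=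
  (Ω[superRing m r c⁄ℂ]) ⧸ LinearMap.range (KaehlerDifferential.D ℂ (superRing m r c)).toLinearMap

/-- The bilinear map `(f, g) ↦ class of f dg`. -/
def diffPairing (m r : ℕ) (c : ℂ) :
    superRing m r c →ₗ[ℂ] superRing m r c →ₗ[ℂ] centre m r c :=
  LinearMap.mk₂ ℂ
    (fun f g => Submodule.Quotient.mk (f • KaehlerDifferential.D ℂ (superRing m r c) g))
    (fun f f' g => by rw [add_smul, Submodule.Quotient.mk_add])
    (fun a f g => by rw [smul_assoc, Submodule.Quotient.mk_smul])
    (fun f g g' => by rw [map_add, smul_add, Submodule.Quotient.mk_add])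
    (fun a f g => by rw [Derivation.map_smul, smul_comm, Submodule.Quotient.mk_smul])

/-- The Lie algebra `sl(2, ℂ)`. -/
abbrev sl2 := LieAlgebra.SpecialLinear.sl (Fin 2) ℂ

def sl2e : sl2 := ⟨!![0, 1; 0, 0], by simp [LieAlgebra.SpecialLinear.sl, Matrix.trace]⟩
def sl2f : sl2 := ⟨!![0, 0; 1, 0], by simp [LieAlgebra.SpecialLinear.sl, Matrix.trace]⟩
def sl2h : sl2 := ⟨!![1, 0; 0, -1], by simp [LieAlgebra.SpecialLinear.sl, Matrix.trace]⟩

/-- The invariant form `(x, y) ↦ tr (x y)`, normalised by `(e, f) = 1`. -/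
def sl2Form : sl2 →ₗ[ℂ] sl2 →ₗ[ℂ] ℂ :=
  LinearMap.mk₂ ℂ (fun x y => Matrix.trace (x.1 * y.1))
    (fun x x' y => by simp [add_mul])
    (fun a x y => by simp)
    (fun x y y' => by simp [mul_add])
    (fun a x y => by simp)

/-- The underlying space `(𝔤 ⊗ A) ⊕ Ω¹_{A/ℂ} / dA` of the universal central extension. -/
abbrev UCE (m r : ℕ) (c : ℂ) : Type := (superRing m r c ⊗[ℂ] sl2) × centre m r c

/-- The cocycle `(x ⊗ f, y ⊗ g) ↦ (x, y) f dg`. -/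
def cocycle (m r : ℕ) (c : ℂ) :
    (superRing m r c ⊗[ℂ] sl2) →ₗ[ℂ] (superRing m r c ⊗[ℂ] sl2) →ₗ[ℂ] centre m r c :=
  (TensorProduct.map₂ (diffPairing m r c) sl2Form).compr₂
    (TensorProduct.rid ℂ (centre m r c)).toLinearMap

/-- The bracket `[x ⊗ f, y ⊗ g] = [x, y] ⊗ f g + (x, y) f dg` of the universal central
extension. -/
def uceBracket {m r : ℕ} {c : ℂ} (x y : UCE m r c) : UCE m r c :=
  (⁅x.1, y.1⁆, cocycle m r c x.1 y.1)

/-- The element `x ⊗ t^i u^l`. -/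
def current (m r : ℕ) (c : ℂ) (x : sl2) (i : ℤ) (l : ℕ) : UCE m r c := (tu m r c i l ⊗ₜ x, 0)

/-- The product `E(z) F(w)` realizes the brackets `[e ⊗ t^i u^l₁, f ⊗ t^j u^l₂]`: with
`E(z) = ∑ ρ(e ⊗ t^i u^l₁) z^(-i-1)`, `F(w) = ∑ ρ(f ⊗ t^j u^l₂) w^(-j-1)`,
`h^(l)(w) = ∑ ρ(h ⊗ t^n u^l) w^(-n-1)` and the centre acting by scalars, `E(z) F(w)` has the
singular part `∑_{i ≥ 0, j} ρ([e ⊗ t^i u^l₁, f ⊗ t^j u^l₂]) z^(-i-1) w^(-j-1)`. For instance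
`∑_{i ≥ 0, j} ρ(h ⊗ t^(i+j) u^l) z^(-i-1) w^(-j-1) = h^(l)(w) / (z - w)`. -/
def RealizesBracket {m : ℕ} [NeZero m] (r : ℕ) (c ε s : ℂ) (l₁ l₂ : Fin m)
    (E F : QField (Fock m)) : Prop :=
  ∃ ρ : UCE m r c →ₗ[ℂ] Module.End ℂ (Fock m),
    (∀ i, ρ (current m r c sl2e i l₁) = fieldMode E i) ∧
    (∀ j, ρ (current m r c sl2f j l₂) = fieldMode F j) ∧
    (∀ (l : Fin m) n, ρ (current m r c sl2h n l) = fieldMode (hField ε s l) n) ∧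
    (∀ ω, ∃ χ : ℂ, ρ (0, ω) = χ • 1) ∧
    OPE E F fun p q =>
      if p < 0 then
        ρ (uceBracket (current m r c sl2e (-p - 1) l₁) (current m r c sl2f (-q - 1) l₂))
      else 0

end Algebra

end Superelliptic

end

open Superelliptic

noncomputable section

/-! Everything is tested on the vacuum. There a normally ordered product reduces to an ordinary
product of its creation parts (`ser_nord`), so a field becomes a Laurent series in w over a
polynomial ring, and partial derivatives in the creation operators read off its monomials. A
derivative in a variable which does not occur in a field commutes with that field. Three kinds of
argument result.

Missing monomials. Part (A), part (D2), and (D3) with l₁ + l₂ ≠ m ask the product to produce a term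
of h^(l'): β^(l') γ^(0), or b^(l') in the case of (D2). Neither factor contributes the relevant
derivative, so the corresponding matrix coefficient of the product vanishes while that of h^(l')
does not. For (A) one also uses that the coefficients of a Laurent series in z - w are eventually
polynomial (`exists_polynomial_of_OPE`), so that the residue is determined by the tail.

Branching. The contraction of exp(αφ(z)) with exp(-αφ(w)) is (1 - w/z)^(-θ), where θ = 2κ²/k is not
an integer (`hat_expCreSer`). A Laurent series in z - w forces a rational function with pole only at
z = w, and by comparing orders at the pole a nonzero rational multiple of (1 - w/z)^(-θ) is never
rational (`exists_int_of_isPolarAt`). This gives (B) and (C) at once. In (D3) with l₁ + l₂ = m the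
summand Z of F carries no exponential, so it must first be removed. The derivative D by b^(0)_(-1)
is nilpotent on the polynomial series Z, and D can be moved across E at the price of a shift of the
mode (`apply_raising_pow`). After D^T only exponential terms are left on the side of the product.
Wick's theorem makes their contraction with E a rational multiple of (1 - w/z)^(-θ)
(`isBinomMultiple_hat`), whereas the bracket predicts a nonzero geometric tail.

Charge. In (D1) there is no exponential in e^(0), hence no branching. The annihilation part of
β^(0), together with the derivative detecting β^(l) γ^(0), selects the terms of F having two more
γ^(0) than β^(0). The charge condition excludes these from Z. So Y alone would have to supply a
nonzero term independent of b^(0)_(-1); but Y is a polynomial times exp(-αφ), and the twisted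
derivative D + ακw is nilpotent on Y while it acts invertibly on such a term
(`coeffMap_twistedDeriv`). -/

namespace Superelliptic

/-! ### Rational power series with a single pole, and non-integral exponents. -/

section Polar

open PowerSeries

variable {𝔽 : Type*} [Field 𝔽]

/-- The power series `f` is rational with no pole except at `ω⁻¹`. -/
def IsPolarAt (ω : 𝔽) (f : PowerSeries 𝔽) : Prop :=
  ∃ (e : ℕ) (P : Polynomial 𝔽), (1 - C ω * X) ^ e * f = (P : PowerSeries 𝔽)

namespace IsPolarAt

variable {ω : 𝔽} {f g : PowerSeries 𝔽}

lemma coe (P : Polynomial 𝔽) : IsPolarAt ω (P : PowerSeries 𝔽) := ⟨0, P, by simp⟩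

lemma zero : IsPolarAt ω (0 : PowerSeries 𝔽) := ⟨0, 0, by simp⟩

lemma const (a : 𝔽) : IsPolarAt ω (C a : PowerSeries 𝔽) := ⟨0, Polynomial.C a, by simp⟩

lemma coe_linear (ω : 𝔽) :
    ((1 - Polynomial.C ω * Polynomial.X : Polynomial 𝔽) : PowerSeries 𝔽) = 1 - C ω * X := by
  simp [sub_eq_add_neg, -map_neg]

lemma mul (hf : IsPolarAt ω f) (hg : IsPolarAt ω g) : IsPolarAt ω (f * g) := by
  obtain ⟨e, P, hP⟩ := hf
  obtain ⟨d, Q, hQ⟩ := hg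
  exact ⟨e + d, P * Q, by rw [Polynomial.coe_mul, ← hP, ← hQ]; ring⟩

lemma add (hf : IsPolarAt ω f) (hg : IsPolarAt ω g) : IsPolarAt ω (f + g) := by
  obtain ⟨e, P, hP⟩ := hf
  obtain ⟨d, Q, hQ⟩ := hg
  refine ⟨e + d, (1 - Polynomial.C ω * Polynomial.X) ^ d * P +
    (1 - Polynomial.C ω * Polynomial.X) ^ e * Q, ?_⟩
  rw [Polynomial.coe_add, Polynomial.coe_mul, Polynomial.coe_mul, Polynomial.coe_pow,
    Polynomial.coe_pow, coe_linear, ← hP, ← hQ]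
  ring

/-- The Euler operator raises the order of the pole by at most one. On coefficients it is
multiplication by the index, which is how polynomial factors enter `mk_eval`. -/
lemma X_mul_derivative (hf : IsPolarAt ω f) : IsPolarAt ω (X * d⁄dX 𝔽 f) := by
  obtain ⟨e, P, hP⟩ := hf
  refine ⟨e + 1, Polynomial.X * ((1 - Polynomial.C ω * Polynomial.X) * Polynomial.derivative P +
    Polynomial.C ((e : 𝔽) * ω) * P), ?_⟩
  have h := congrArg (d⁄dX 𝔽) hP
  have hC : d⁄dX 𝔽 (C ω : PowerSeries 𝔽) = 0 := derivative_C
  have hX : d⁄dX 𝔽 (1 - C ω * X : PowerSeries 𝔽) = - C ω := by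
    simp [Derivation.leibniz, hC]
  have hd : (Polynomial.derivative P : PowerSeries 𝔽) =
      d⁄dX 𝔽 ((1 - C ω * X) ^ e * f) := by
    rw [hP, derivative_coe]
  rw [Polynomial.coe_mul, Polynomial.coe_add, Polynomial.coe_mul, Polynomial.coe_mul, coe_linear,
    hd, ← hP, Derivation.leibniz, Derivation.leibniz_pow, hX]
  simp only [smul_eq_mul, nsmul_eq_mul, Polynomial.coe_X, Polynomial.coe_C]
  rw [map_mul C, map_natCast]
  rcases e with _ | e
  · simp; ring
  · simp only [Nat.add_sub_cancel]
    ring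

/-- Finitely many coefficients change a series by a polynomial only. Operator product expansions
control just the tail in z⁻¹, and this is enough for rationality. -/
lemma congr (N : ℕ) (h : ∀ j, N ≤ j → coeff j f = coeff j g) (hg : IsPolarAt ω g) :
    IsPolarAt ω f := by
  have : f = g + ((trunc N (f - g) : Polynomial 𝔽) : PowerSeries 𝔽) := by
    ext j
    rw [map_add, Polynomial.coeff_coe, coeff_trunc]
    split_ifs with hj
    · simp
    · simp [h j (not_lt.mp hj)]
  rw [this]
  exact hg.add (coe _)

lemma geom (ω : 𝔽) : IsPolarAt ω (mk fun j => ω ^ j) := by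
  refine ⟨1, 1, ?_⟩
  ext j
  rcases j with _ | j
  · simp [sub_mul]
  · rw [pow_one, sub_mul, one_mul, mul_assoc, map_sub, coeff_C_mul, coeff_succ_X_mul, coeff_mk,
      coeff_mk, Polynomial.coe_one, coeff_one, if_neg (Nat.succ_ne_zero j), pow_succ']
    ring

lemma mk_eval (ω : 𝔽) (q : Polynomial 𝔽) : IsPolarAt ω (mk fun j => q.eval (j : 𝔽) * ω ^ j) := by
  induction q using Polynomial.induction_on' with
  | add p q hp hq =>
    convert hp.add hq using 1
    ext j
    simp [add_mul]
  | monomial n a =>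
    induction n with
    | zero =>
      convert (const a).mul (geom ω) using 1
      ext j
      simp
    | succ n ih =>
      convert ih.X_mul_derivative using 1
      ext j
      rcases j with _ | j
      · simp
      · simp [coeff_succ_X_mul, coeff_derivative, pow_succ]
        ring

end IsPolarAt

/-- A nonzero solution of `(1 - ω X) g' = θ ω g` is not rational unless `θ` is an integer. -/
theorem exists_int_of_polynomial_mul_eq [CharZero 𝔽] {ω θ : 𝔽} (hω : ω ≠ 0) {g : PowerSeries 𝔽}
    (hg : (1 - C ω * X) * d⁄dX 𝔽 g = C (θ * ω) * g) (hg0 : g ≠ 0) {P Q : Polynomial 𝔽}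
    (hP : P ≠ 0) (h : (P : PowerSeries 𝔽) * g = Q) : ∃ n : ℤ, θ = n := by
  have hQ : Q ≠ 0 := by
    rintro rfl
    rw [Polynomial.coe_zero, mul_eq_zero] at h
    rcases h with h | h
    · exact hP (by exact_mod_cast h)
    · exact hg0 h
  have hd := congrArg (d⁄dX 𝔽) h
  rw [Derivation.leibniz, smul_eq_mul, smul_eq_mul, derivative_coe, derivative_coe] at hd
  -- The logarithmic derivative g'/g = Q'/Q - P'/P with denominators cleared.
  have key : (1 - Polynomial.C ω * Polynomial.X) * Polynomial.derivative P * Q +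
      Polynomial.C (θ * ω) * P * Q =
      (1 - Polynomial.C ω * Polynomial.X) * Polynomial.derivative Q * P := by
    apply Polynomial.coe_injective 𝔽
    simp only [Polynomial.coe_add, Polynomial.coe_mul, IsPolarAt.coe_linear, Polynomial.coe_C]
    rw [← hd, ← h]
    linear_combination (-(P : PowerSeries 𝔽) ^ 2) * hg
  obtain ⟨P₀, hP₀, hP₁⟩ := Polynomial.exists_eq_pow_rootMultiplicity_mul_and_not_dvd P hP ω⁻¹
  obtain ⟨Q₀, hQ₀, hQ₁⟩ := Polynomial.exists_eq_pow_rootMultiplicity_mul_and_not_dvd Q hQ ω⁻¹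
  set a := Polynomial.rootMultiplicity ω⁻¹ P
  set b := Polynomial.rootMultiplicity ω⁻¹ Q
  set U : Polynomial 𝔽 := Polynomial.X - Polynomial.C ω⁻¹ with hU
  have hU0 : U ≠ 0 := Polynomial.X_sub_C_ne_zero _
  have hU1 : Polynomial.derivative U = 1 := by simp [hU]
  have hlin : (1 - Polynomial.C ω * Polynomial.X : Polynomial 𝔽) = - Polynomial.C ω * U := by
    rw [hU, mul_sub, neg_mul, neg_mul, ← Polynomial.C_mul, mul_inv_cancel₀ hω]
    simp; ring
  have hder : ∀ (n : ℕ) (R : Polynomial 𝔽), U * Polynomial.derivative (U ^ n * R) =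
      U ^ n * ((n : Polynomial 𝔽) * R + U * Polynomial.derivative R) := by
    intro n R
    rcases n with _ | n
    · simp
    · rw [Polynomial.derivative_mul, Polynomial.derivative_pow, hU1]
      simp only [Nat.add_sub_cancel, map_natCast]
      ring
  have hC : (Polynomial.C ω : Polynomial 𝔽) ≠ 0 := by simpa using hω
  -- Comparison of residues at ω⁻¹. Once the common power of `U` is cancelled, evaluation at ω⁻¹
  -- leaves (a - b - θ) P₀ Q₀ = 0 with P₀ and Q₀ nonzero there, so θ is the difference of the two
  -- multiplicities.
  have e1 : U ^ (a + b) * Polynomial.C ω * (((a : Polynomial 𝔽) * P₀ + U * Polynomial.derivative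
    P₀) * Q₀ -
      Polynomial.C θ * P₀ * Q₀ - ((b : Polynomial 𝔽) * Q₀ + U * Polynomial.derivative Q₀) * P₀) = 0
        := by
    have h1 := hder a P₀
    have h2 := hder b Q₀
    rw [← hP₀] at h1
    rw [← hQ₀] at h2
    rw [hlin, Polynomial.C_mul] at key
    have : U ^ (a + b) * Polynomial.C ω * (((a : Polynomial 𝔽) * P₀ + U * Polynomial.derivative P₀)
      * Q₀ -
      Polynomial.C θ * P₀ * Q₀ - ((b : Polynomial 𝔽) * Q₀ + U * Polynomial.derivative Q₀) * P₀) =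
      Polynomial.C ω * ((U * Polynomial.derivative P) * (U ^ b * Q₀) -
       Polynomial.C θ * (U ^ a * P₀) * (U ^ b * Q₀) - (U * Polynomial.derivative Q) * (U ^ a * P₀))
         := by
      rw [h1, h2]; ring
    rw [this, ← hP₀, ← hQ₀]
    linear_combination -key
  have e2 := (mul_eq_zero.mp e1).resolve_left (mul_ne_zero (pow_ne_zero _ hU0) hC)
  have e3 := congrArg (Polynomial.eval ω⁻¹) e2
  have hp : P₀.eval ω⁻¹ ≠ 0 := fun h => hP₁ (Polynomial.dvd_iff_isRoot.mpr h)
  have hq : Q₀.eval ω⁻¹ ≠ 0 := fun h => hQ₁ (Polynomial.dvd_iff_isRoot.mpr h)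
  simp [hU] at e3
  refine ⟨(a : ℤ) - b, ?_⟩
  have : P₀.eval ω⁻¹ * Q₀.eval ω⁻¹ * ((a : 𝔽) - b - θ) = 0 := by linear_combination e3
  have := (mul_eq_zero.mp this).resolve_left (mul_ne_zero hp hq)
  push_cast
  linear_combination -this

/-- If a rational multiple of `g` is rational and not zero, then `θ` is an integer. -/
theorem exists_int_of_isPolarAt [CharZero 𝔽] {ω θ : 𝔽} (hω : ω ≠ 0) {g : PowerSeries 𝔽}
    (hg : (1 - C ω * X) * d⁄dX 𝔽 g = C (θ * ω) * g) {r : PowerSeries 𝔽} (hr : IsPolarAt ω r)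
    (hrg : IsPolarAt ω (r * g)) (h0 : r * g ≠ 0) : ∃ n : ℤ, θ = n := by
  obtain ⟨e, P, hP⟩ := hr
  obtain ⟨d, Q, hQ⟩ := hrg
  have hlin : (1 - C ω * X : PowerSeries 𝔽) ≠ 0 := fun h => by simpa using congrArg (coeff 0) h
  refine exists_int_of_polynomial_mul_eq hω hg (right_ne_zero_of_mul h0)
    (P := (1 - Polynomial.C ω * Polynomial.X) ^ d * P)
    (Q := (1 - Polynomial.C ω * Polynomial.X) ^ e * Q) ?_ ?_
  · intro h
    have := congrArg (fun p : Polynomial 𝔽 => (p : PowerSeries 𝔽)) h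
    simp only [Polynomial.coe_mul, Polynomial.coe_pow, IsPolarAt.coe_linear, ← hP,
      Polynomial.coe_zero] at this
    exact mul_ne_zero (pow_ne_zero _ hlin) (mul_ne_zero (pow_ne_zero _ hlin)
      (left_ne_zero_of_mul h0)) this
  · simp only [Polynomial.coe_mul, Polynomial.coe_pow, IsPolarAt.coe_linear, ← hP, ← hQ]
    ring

end Polar

/-! ### Fields on the vacuum as Laurent series over the Fock space. -/

section Laurent

open HahnSeries MvPolynomial

/-- Coefficientwise application of a linear map to a Laurent series. -/
def coeffMap {M N : Type*} [AddCommGroup M] [Module ℂ M] [AddCommGroup N] [Module ℂ N]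
    (f : M →ₗ[ℂ] N) : LaurentSeries M →ₗ[ℂ] LaurentSeries N where
  toFun u := u.map f
  map_add' u v := by ext n; simp
  map_smul' c u := by ext n; simp

@[simp]
lemma coeff_coeffMap {M N : Type*} [AddCommGroup M] [Module ℂ M] [AddCommGroup N] [Module ℂ N]
    (f : M →ₗ[ℂ] N) (u : LaurentSeries M) (n : ℤ) : (coeffMap f u).coeff n = f (u.coeff n) := rfl

lemma coeffMap_single_mul {R S : Type*} [CommRing R] [Algebra ℂ R] [CommRing S] [Algebra ℂ S]
    (f : R →ₗ[ℂ] S) (k : ℤ) (u : LaurentSeries R) :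
    coeffMap f (single k 1 * u) = single k 1 * coeffMap f u := by
  ext n
  simp [coeff_single_mul]

variable {m : ℕ}

/-- The coefficientwise algebra structure on Laurent series over the Fock space. -/
instance coeffAlgebra : Algebra ℂ (LaurentSeries (Fock m)) :=
  HahnSeries.instAlgebra

/-- Coefficientwise application of a derivation to a Laurent series. -/
def coeffDeriv (D : Derivation ℂ (Fock m) (Fock m)) :
    Derivation ℂ (LaurentSeries (Fock m)) (LaurentSeries (Fock m)) :=
  Derivation.mk' (coeffMap (M := Fock m) (N := Fock m) D.toLinearMap) fun u v => by
    ext1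
    funext n
    have h1 : (coeffMap (M := Fock m) (N := Fock m) D.toLinearMap u).support ⊆ u.support := by
      intro i hi h
      exact hi (by simp [show u.coeff i = 0 from h])
    have h2 : (coeffMap (M := Fock m) (N := Fock m) D.toLinearMap v).support ⊆ v.support := by
      intro i hi h
      exact hi (by simp [show v.coeff i = 0 from h])
    rw [smul_eq_mul, smul_eq_mul, mul_comm v, HahnSeries.coeff_add, coeff_mul_right'
      v.isPWO_support h2,
      coeff_mul_left' u.isPWO_support h1, coeff_coeffMap, HahnSeries.coeff_mul, map_sum,
      ← Finset.sum_add_distrib]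
    refine Finset.sum_congr rfl fun p _ => ?_
    simp [mul_comm]

@[simp]
lemma coeff_coeffDeriv (D : Derivation ℂ (Fock m) (Fock m))
    (u : LaurentSeries (Fock m)) (n : ℤ) : (coeffDeriv D u).coeff n = D (u.coeff n) := rfl

lemma coeffDeriv_single_one (D : Derivation ℂ (Fock m) (Fock m)) (k : ℤ) :
    coeffDeriv D (single k 1) = 0 := by
  ext n
  rw [coeff_coeffDeriv, coeff_single]
  split_ifs <;> simp

/-- The partial derivative of a Laurent series with coefficients in the Fock space. -/
abbrev fockDeriv (x : Osc m) : Derivation ℂ (LaurentSeries (Fock m)) (LaurentSeries (Fock m)) :=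
  coeffDeriv (pderiv x)

lemma coeff_mul_eq_finsum {R : Type*} [CommRing R] (u v : LaurentSeries R) (n : ℤ) :
    (u * v).coeff n = ∑ᶠ i : ℤ, u.coeff i * v.coeff (n - i) := by
  classical
  rw [HahnSeries.coeff_mul, finsum_eq_sum_of_support_subset (s := (Finset.antidiagonal
    u.isPWO_support
    v.isPWO_support n).image Prod.fst), Finset.sum_image]
  · refine Finset.sum_congr rfl fun p hp => ?_
    rw [Finset.mem_antidiagonal] at hp
    rw [← hp.2.2, add_sub_cancel_left]
  · intro p hp q hq h
    have hp := (Finset.mem_antidiagonal.mp hp).2.2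
    have hq := (Finset.mem_antidiagonal.mp hq).2.2
    ext <;> (simp_all; try omega)
  · intro i hi
    simp only [Finset.coe_image, Set.mem_image, Finset.mem_coe, Finset.mem_antidiagonal]
    exact ⟨(i, n - i), ⟨left_ne_zero_of_mul hi, right_ne_zero_of_mul hi, by simp⟩, rfl⟩

/-- The action of a field on the vacuum. -/
def ser : QField (Fock m) →ₗ[ℂ] LaurentSeries (Fock m) where
  toFun A := ofSuppBddBelow (fun n => A.1 n 1) (by
    obtain ⟨K, hK⟩ := A.2 1
    exact ⟨K, fun n hn => not_lt.mp fun h => hn (hK n h)⟩)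
  map_add' A B := by ext n; simp
  map_smul' c A := by ext n; simp

@[simp]
lemma coeff_ser (A : QField (Fock m)) (n : ℤ) : (ser A).coeff n = A.1 n 1 := rfl

/-- The creation part of a letter, applied to the vacuum. -/
def creSer (ε : ℂ) (b : Gen m × ℕ) : LaurentSeries (Fock m) :=
  ofSuppBddBelow (fun n => (letterField ε b).cre n 1) (by
    obtain ⟨K, hK⟩ := (letterField ε b).cre_lb
    exact ⟨K, fun n hn => not_lt.mp fun h => hn (by simp [hK n h])⟩)

/-- The oscillator created by the generating field `g`. -/
def oscOf : Gen m → ℕ → Osc m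
  | .beta l, n => .beta l n
  | .gamma l, n => .gamma l n
  | .heis l, n => .heis l n

lemma oscOf_inj {g g' : Gen m} {n n' : ℕ} : oscOf g n = oscOf g' n' ↔ g = g' ∧ n = n' := by
  cases g <;> cases g' <;> simp [oscOf]

/-- The exponent of the first creation operator in the generating field `g`. -/
def lowExp : Gen m → ℤ
  | .beta _ => -1
  | .gamma _ => 1
  | .heis _ => 0

/-- The polynomial `(X + 1) ⋯ (X + d)`. -/
def derivPoly : ℕ → Polynomial ℂ
  | 0 => 1
  | d + 1 => (Polynomial.X + 1) * (derivPoly d).comp (Polynomial.X + 1)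

lemma iterate_deriv_modes {V : Type} [AddCommGroup V] [Module ℂ V] (a : FreeField V) (d : ℕ)
    (i : ℤ) :
    (FreeField.deriv^[d] a).cre i = (derivPoly d).eval (i : ℂ) • a.cre (i + d) ∧
    (FreeField.deriv^[d] a).ann i = (derivPoly d).eval (i : ℂ) • a.ann (i + d) := by
  induction d generalizing i with
  | zero => simp [derivPoly]
  | succ d ih =>
    rw [Function.iterate_succ_apply']
    simp only [FreeField.deriv, derivSeries, ih, derivPoly, Polynomial.eval_mul,
      Polynomial.eval_add, Polynomial.eval_X, Polynomial.eval_one, Polynomial.eval_comp, smul_smul]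
    push_cast
    rw [show i + 1 + (d : ℤ) = i + (d + 1) by ring]
    exact ⟨rfl, rfl⟩

lemma genField_cre (ε : ℂ) (g : Gen m) (i : ℤ) : (genField ε g).cre i =
    if lowExp g ≤ i then create (oscOf g (i - lowExp g).toNat) else 0 := by
  have h : IsAnn g (modeIndex g i) ↔ ¬ lowExp g ≤ i := by
    cases g <;> simp only [IsAnn, modeIndex, lowExp] <;> omega
  by_cases hi : lowExp g ≤ i
  · rw [if_pos hi]
    refine (if_neg (by rwa [h, not_not])).trans ?_
    cases g <;> simp only [lowExp] at hi <;> simp only [mode] <;>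
      refine (if_pos (by simp only [modeIndex]; omega)).trans ?_ <;>
      simp only [modeIndex, oscOf, lowExp] <;> congr 2 <;> omega
  · rw [if_neg hi]
    exact if_pos (h.mpr hi)

lemma letterField_cre (ε : ℂ) (b : Gen m × ℕ) (i : ℤ) : (letterField ε b).cre i =
    if lowExp b.1 ≤ i + b.2 then
      (derivPoly b.2).eval (i : ℂ) • create (oscOf b.1 (i + b.2 - lowExp b.1).toNat) else 0 := by
  rw [letterField, (iterate_deriv_modes _ _ _).1, genField_cre]
  split_ifs <;> simp

lemma letterField_cre_apply (ε : ℂ) (b : Gen m × ℕ) (i : ℤ) (v : Fock m) :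
    (letterField ε b).cre i v = (creSer ε b).coeff i * v := by
  simp only [creSer, coeff_ofSuppBddBelow, letterField_cre]
  split_ifs <;> simp [create]

lemma coeff_creSer (ε : ℂ) (b : Gen m × ℕ) (i : ℤ) : (creSer ε b).coeff i =
    if lowExp b.1 ≤ i + b.2 then
      (derivPoly b.2).eval (i : ℂ) • X (oscOf b.1 (i + b.2 - lowExp b.1).toNat) else 0 := by
  simp only [creSer, coeff_ofSuppBddBelow, letterField_cre]
  split_ifs <;> simp [create]

lemma genField_ann_eq_smul (ε : ℂ) (g : Gen m) (i : ℤ) :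
    ∃ (c : ℂ) (x : Osc m), (genField ε g).ann i = c • annih x := by
  by_cases h : IsAnn g (modeIndex g i)
  · simp only [genField, h, if_true]
    cases g with
    | beta l => exact ⟨_, _, by simp only [IsAnn] at h; rw [mode, if_neg (by omega)]⟩
    | gamma l => exact ⟨_, _, by simp only [IsAnn] at h; rw [mode, if_neg (by omega)]⟩
    | heis l =>
      simp only [IsAnn] at h
      rw [mode, if_neg (by omega)]
      split_ifs
      · exact ⟨0, .heis l 0, by simp⟩
      · exact ⟨_, _, rfl⟩
  · simp only [genField, h, if_false]
    exact ⟨0, oscOf g 0, by simp⟩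

lemma letterField_ann_eq_smul (ε : ℂ) (b : Gen m × ℕ) (i : ℤ) :
    ∃ (c : ℂ) (x : Osc m), (letterField ε b).ann i = c • annih x := by
  obtain ⟨c, x, h⟩ := genField_ann_eq_smul ε b.1 (i + b.2)
  exact ⟨_, x, by rw [letterField, (iterate_deriv_modes _ _ _).2, h, smul_smul]⟩

lemma nprod_apply {V : Type} [AddCommGroup V] [Module ℂ V] (a : FreeField V) (A : QField V) (n : ℤ)
    (v : V) : (nprod a A).1 n v =
      (∑ᶠ i : ℤ, a.cre i (A.1 (n - i) v)) + ∑ᶠ i : ℤ, A.1 (n - i) (a.ann i v) := rfl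

/-- Annihilation operators kill the vacuum, so only the creation half of the ordered product
survives, and that half acts by multiplication. -/
lemma ser_nprod (ε : ℂ) (b : Gen m × ℕ) (A : QField (Fock m)) :
    ser (nprod (letterField ε b) A) = creSer ε b * ser A := by
  ext1
  funext n
  have h : ∀ i, (letterField ε b).ann i 1 = 0 := by
    intro i
    obtain ⟨c, x, h⟩ := letterField_ann_eq_smul ε b i
    simp [h, annih]
  rw [coeff_ser, nprod_apply, coeff_mul_eq_finsum]
  simp only [letterField_cre_apply, h, map_zero, finsum_zero, add_zero, coeff_ser]

/-- The product of the creation parts of the letters of `L`. -/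
def creProd (ε : ℂ) (L : List (Gen m × ℕ)) : LaurentSeries (Fock m) := (L.map (creSer ε)).prod

@[simp]
lemma creProd_nil (ε : ℂ) : creProd ε ([] : List (Gen m × ℕ)) = 1 := rfl

@[simp]
lemma creProd_cons (ε : ℂ) (b : Gen m × ℕ) (L : List (Gen m × ℕ)) :
    creProd ε (b :: L) = creSer ε b * creProd ε L := by simp [creProd]

lemma creProd_append (ε : ℂ) (L M : List (Gen m × ℕ)) :
    creProd ε (L ++ M) = creProd ε L * creProd ε M := by simp [creProd]

lemma ser_nord (ε : ℂ) (L : List (Gen m × ℕ)) (B : QField (Fock m)) :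
    ser (nord ε L B) = creProd ε L * ser B := by
  induction L with
  | nil => simp [nord]
  | cons b L ih =>
    rw [nord, List.foldr_cons, ser_nprod, creProd_cons, mul_assoc, ← ih]
    rfl

lemma ser_oneField : ser (oneField (Fock m)) = 1 := by
  ext1
  funext n
  rw [coeff_ser, HahnSeries.coeff_one, oneField]
  by_cases h : n = 0
  · subst h; simp
  · simp [h]

lemma fockDeriv_creSer_of_ne (ε : ℂ) (b : Gen m × ℕ) (x : Osc m) (h : ∀ n, x ≠ oscOf b.1 n) :
    fockDeriv x (creSer ε b) = 0 := by
  ext1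
  funext n
  rw [coeff_coeffDeriv, coeff_creSer]
  split_ifs
  · rw [Derivation.map_smul, pderiv_X_of_ne (h _).symm, smul_zero]; rfl
  · simp

lemma fockDeriv_creSer_self (ε : ℂ) (b : Gen m × ℕ) (k : ℕ) :
    fockDeriv (oscOf b.1 k) (creSer ε b) =
      (derivPoly b.2).eval ((k + lowExp b.1 - b.2 : ℤ) : ℂ) • single (k + lowExp b.1 - b.2 : ℤ) 1
        := by
  ext1
  funext n
  rw [coeff_coeffDeriv, coeff_creSer, HahnSeries.coeff_smul]
  by_cases hn : n = k + lowExp b.1 - b.2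
  · subst hn
    rw [coeff_single_same, if_pos (by omega), Derivation.map_smul,
      show ((k + lowExp b.1 - b.2 + b.2 - lowExp b.1 : ℤ)).toNat = k by omega, pderiv_X_self]
  · rw [coeff_single_of_ne hn, smul_zero]
    split_ifs with h
    · rw [Derivation.map_smul, pderiv_X_of_ne, smul_zero]
      intro h'
      have := (oscOf_inj.mp h').2
      omega
    · simp

/-- A letter is linear in the oscillators and contains each of them in at most one power of the
variable. Its derivatives are therefore scalar monomials, constant for every further derivative. -/
lemma exists_fockDeriv_creSer (ε : ℂ) (b : Gen m × ℕ) (x : Osc m) :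
    ∃ (c : ℂ) (k : ℤ), fockDeriv x (creSer ε b) = c • single k 1 := by
  by_cases h : ∃ k, x = oscOf b.1 k
  · obtain ⟨k, rfl⟩ := h
    exact ⟨_, _, fockDeriv_creSer_self ε b k⟩
  · push Not at h
    exact ⟨0, 0, by rw [fockDeriv_creSer_of_ne ε b x h, zero_smul]⟩

lemma fockDeriv_creProd_eq_zero (ε : ℂ) (L : List (Gen m × ℕ)) (x : Osc m)
    (h : ∀ b ∈ L, ∀ n, x ≠ oscOf b.1 n) : fockDeriv x (creProd ε L) = 0 := by
  induction L with
  | nil => simp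
  | cons b L ih =>
    rw [creProd_cons, Derivation.leibniz, ih fun b hb => h b (List.mem_cons_of_mem _ hb),
      fockDeriv_creSer_of_ne ε b x (h b List.mem_cons_self)]
    simp

lemma pderiv_pderiv (x y : Osc m) (v : Fock m) : pderiv x (pderiv y v) = pderiv y (pderiv x v) := by
  ext n
  simp only [MvPolynomial.coeff_pderiv]
  by_cases h : x = y
  · subst h; ring
  · simp [h, Ne.symm h, add_right_comm]
    ring

end Laurent

/-! ### Formal exponentials and the binomial series. -/

section Exponential

open PowerSeries

variable {R S : Type*} [CommRing R] [Algebra ℂ R] [CommRing S] [Algebra ℂ S]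

/-- The exponential of a power series without constant term. -/
def expSeries (φ : PowerSeries R) : PowerSeries R :=
  mk fun n => ∑ p ∈ Finset.range (n + 1), ((p.factorial : ℂ)⁻¹) • coeff n (φ ^ p)

/-- Partial sum of the exponential series. -/
def expPartial (φ : PowerSeries R) (N : ℕ) : PowerSeries R :=
  ∑ p ∈ Finset.range N, ((p.factorial : ℂ)⁻¹) • φ ^ p

/-- Since φ has no constant term, φ^p starts in degree p. Each coefficient thus sees a finite
partial sum, to which derivations apply term by term. -/
lemma coeff_expSeries {φ : PowerSeries R} (h : constantCoeff φ = 0) {n N : ℕ} (hN : n < N) :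
    coeff n (expSeries φ) = coeff n (expPartial φ N) := by
  rw [expSeries, coeff_mk, expPartial, map_sum]
  simp only [coeff_smul]
  refine Finset.sum_subset (fun p hp => by simp at hp ⊢; omega) fun p _ hp => ?_
  have : X ^ p ∣ φ ^ p := pow_dvd_pow_of_dvd (X_dvd_iff.mpr h) p
  rw [X_pow_dvd_iff.mp this n (by simpa using hp), smul_zero]

lemma coeff_mul_expSeries {φ : PowerSeries R} (h : constantCoeff φ = 0) (f : PowerSeries R)
    {n N : ℕ} (hN : n < N) : coeff n (f * expSeries φ) = coeff n (f * expPartial φ N) := by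
  rw [coeff_mul, coeff_mul]
  refine Finset.sum_congr rfl fun p hp => ?_
  rw [Finset.HasAntidiagonal.mem_antidiagonal] at hp
  rw [coeff_expSeries h (N := N) (by omega)]

lemma derivation_expPartial (D : Derivation ℂ (PowerSeries R) (PowerSeries R)) (φ : PowerSeries R)
    (N : ℕ) : D (expPartial φ (N + 1)) = D φ * expPartial φ N := by
  rw [expPartial, Finset.sum_range_succ', map_add, map_sum, expPartial, Finset.mul_sum]
  simp only [pow_zero, Nat.factorial_zero, Nat.cast_one, inv_one, one_smul,
    Derivation.map_one_eq_zero, add_zero]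
  refine Finset.sum_congr rfl fun p _ => ?_
  have hp : ((p : ℂ) + 1) ≠ 0 := by exact_mod_cast Nat.succ_ne_zero p
  rw [Derivation.map_smul, Derivation.leibniz_pow, Nat.add_sub_cancel, Nat.factorial_succ,
    ← Nat.cast_smul_eq_nsmul ℂ, smul_smul, Nat.cast_mul, mul_inv, mul_comm _ (_ : ℂ)⁻¹, mul_assoc,
    Nat.cast_succ, inv_mul_cancel₀ hp, mul_one, smul_eq_mul, mul_smul_comm, mul_comm]

/-- Coefficientwise application of a derivation to a power series. -/
def powerDeriv (D : Derivation ℂ R R) : Derivation ℂ (PowerSeries R) (PowerSeries R) :=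
  Derivation.mk'
    { toFun := fun f => mk fun n => D (coeff n f)
      map_add' := fun f g => by ext n; simp
      map_smul' := fun c f => by ext n; simp } fun f g => by
    ext n
    simp only [LinearMap.coe_mk, AddHom.coe_mk, coeff_mk, smul_eq_mul, map_add]
    rw [mul_comm g, coeff_mul, coeff_mul, coeff_mul, map_sum, ← Finset.sum_add_distrib]
    exact Finset.sum_congr rfl fun p _ => by simp [mul_comm]

@[simp]
lemma coeff_powerDeriv (D : Derivation ℂ R R) (f : PowerSeries R) (n : ℕ) :
    coeff n (powerDeriv D f) = D (coeff n f) := by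
  change coeff n (mk fun n => D (coeff n f)) = _
  simp

lemma powerDeriv_expSeries (D : Derivation ℂ R R) {φ : PowerSeries R} (h : constantCoeff φ = 0) :
    powerDeriv D (expSeries φ) = powerDeriv D φ * expSeries φ := by
  ext n
  rw [coeff_powerDeriv, coeff_expSeries h (N := n + 2) (by omega), ← coeff_powerDeriv,
    derivation_expPartial, coeff_mul_expSeries h _ (N := n + 1) (by omega)]

lemma derivative_expSeries {φ : PowerSeries R} (h : constantCoeff φ = 0) :
    d⁄dX R (expSeries φ) = d⁄dX R φ * expSeries φ := by
  ext n
  rw [coeff_derivative, coeff_expSeries h (N := n + 2) (by omega), ← coeff_derivative,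
    coeff_mul_expSeries h _ (N := n + 1) (by omega)]
  exact congrArg (coeff n) (derivation_expPartial ((d⁄dX R).restrictScalars ℂ) φ (n + 1))

lemma map_expSeries (τ : R →ₐ[ℂ] S) (φ : PowerSeries R) :
    map (τ : R →+* S) (expSeries φ) = expSeries (map (τ : R →+* S) φ) := by
  ext n
  simp only [expSeries, coeff_map, coeff_mk, map_sum, ← map_pow]
  exact Finset.sum_congr rfl fun p _ => by simp

lemma rescale_expSeries (c : R) (φ : PowerSeries R) :
    rescale c (expSeries φ) = expSeries (rescale c φ) := by
  ext n
  simp only [expSeries, coeff_rescale, coeff_mk, ← map_pow, Finset.mul_sum, mul_smul_comm]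

/-- The coefficients of `(1 - X)^(-θ) = exp (θ ∑ X^j / j)`. -/
def binomSeries (θ : ℂ) : PowerSeries ℂ := expSeries (mk fun j => θ / (j : ℂ))

lemma coeff_zero_binomSeries (θ : ℂ) : coeff 0 (binomSeries θ) = 1 := by
  simp [binomSeries, expSeries]

/-- Coefficientwise form of (1 - X) g' = θ g, which follows from g' = φ' g and (1 - X) φ' = θ for φ
= θ ∑ X^j / j. -/
lemma coeff_succ_binomSeries (θ : ℂ) (j : ℕ) :
    coeff (j + 1) (binomSeries θ) * ((j : ℂ) + 1) = (θ + j) * coeff j (binomSeries θ) := by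
  have h0 : constantCoeff (mk fun j => θ / (j : ℂ) : PowerSeries ℂ) = 0 := by
    simp [← coeff_zero_eq_constantCoeff_apply]
  have h := derivative_expSeries h0
  have h1 : (1 - X) * d⁄dX ℂ (mk fun j => θ / (j : ℂ) : PowerSeries ℂ) = C θ := by
    ext j
    have hj : ∀ j : ℕ, ((j : ℂ) + 1) ≠ 0 := fun j => by exact_mod_cast Nat.succ_ne_zero j
    rcases j with _ | j
    · rw [sub_mul, one_mul, map_sub, PowerSeries.coeff_zero_X_mul, coeff_derivative]
      simp
    · rw [sub_mul, one_mul, map_sub, coeff_succ_X_mul, coeff_derivative, coeff_derivative, coeff_mk,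
        coeff_mk, coeff_C, if_neg (Nat.succ_ne_zero j)]
      push_cast
      rw [div_mul_cancel₀ _ (hj j), div_mul_cancel₀, sub_self]
      exact_mod_cast hj (j + 1)
  have h2 : (1 - X) * d⁄dX ℂ (binomSeries θ) = C θ * binomSeries θ := by
    rw [binomSeries, h, ← mul_assoc, h1]
  have h3 := congrArg (coeff j) h2
  rw [coeff_C_mul, sub_mul, one_mul, map_sub, coeff_derivative] at h3
  rcases j with _ | j
  · simp at h3 ⊢
    exact h3
  · rw [coeff_succ_X_mul, coeff_derivative] at h3
    push_cast at h3 ⊢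
    linear_combination h3

/-- The series `(1 - ω X)^(-θ)` over an extension of `ℂ`. -/
def binomSeriesAt {𝔽 : Type*} [Field 𝔽] (ι : ℂ →+* 𝔽) (ω : 𝔽) (θ : ℂ) : PowerSeries 𝔽 :=
  mk fun j => ι (coeff j (binomSeries θ)) * ω ^ j

lemma binomSeriesAt_ne_zero {𝔽 : Type*} [Field 𝔽] (ι : ℂ →+* 𝔽) (ω : 𝔽) (θ : ℂ) :
    binomSeriesAt ι ω θ ≠ 0 := fun h => by
  simpa [binomSeriesAt, coeff_zero_binomSeries] using congrArg (coeff 0) h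

lemma binomSeriesAt_ode {𝔽 : Type*} [Field 𝔽] (ι : ℂ →+* 𝔽) (ω : 𝔽) (θ : ℂ) :
    (1 - C ω * X) * d⁄dX 𝔽 (binomSeriesAt ι ω θ) = C (ι θ * ω) * binomSeriesAt ι ω θ := by
  ext j
  have h := congrArg ι (coeff_succ_binomSeries θ j)
  simp only [map_mul, map_add, map_natCast, map_one] at h
  rw [coeff_C_mul, sub_mul, one_mul, mul_assoc, map_sub, coeff_C_mul, coeff_derivative,
    binomSeriesAt, coeff_mk, coeff_mk]
  rcases j with _ | j
  · simp at h ⊢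
    rw [h]; ring
  · rw [coeff_succ_X_mul, coeff_derivative, coeff_mk]
    push_cast at h ⊢
    linear_combination ω ^ (j + 2) * h

end Exponential

/-! ### The exponentials of the scalar field. -/

section VertexOperator

open MvPolynomial HahnSeries

variable {m : ℕ} [NeZero m]

lemma constantCoeff_phiCre (κ a : ℂ) :
    PowerSeries.constantCoeff (phiCre κ a : PowerSeries (Fock m)) = 0 := by
  simp [phiCre, ← PowerSeries.coeff_zero_eq_constantCoeff_apply]

lemma expCre_natCast (κ a : ℂ) (n : ℕ) :
    (expCre κ a n : Fock m) = PowerSeries.coeff n (expSeries (phiCre κ a)) := by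
  simp [expCre, expSeries]

lemma expCre_of_neg (κ a : ℂ) {n : ℤ} (h : n < 0) : (expCre κ a n : Fock m) = 0 := by
  rw [expCre, if_neg (by omega)]

lemma pderiv_expCre_of_ne (κ a : ℂ) (x : Osc m) (hx : ∀ j, x ≠ .heis 0 j) (n : ℤ) :
    pderiv x (expCre κ a n : Fock m) = 0 := by
  rcases lt_or_ge n 0 with h | h
  · rw [expCre_of_neg _ _ h, map_zero]
  · lift n to ℕ using h
    have h0 : powerDeriv (pderiv x) (phiCre κ a : PowerSeries (Fock m)) = 0 := by
      ext1 j
      rw [coeff_powerDeriv, phiCre, PowerSeries.coeff_mk]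
      split_ifs
      · simp
      · rw [Derivation.map_smul, pderiv_X_of_ne (hx _).symm, smul_zero, map_zero]
    rw [expCre_natCast, ← coeff_powerDeriv, powerDeriv_expSeries _ (constantCoeff_phiCre κ a), h0,
      zero_mul, map_zero]

/-- The variable b^(0)_(-1) enters a φ_cre(z) as aκ z b^(0)_(-1); differentiation multiplies the
exponential by aκ z, which shifts the index by one. -/
lemma pderiv_heis_expCre (κ a : ℂ) (n : ℤ) :
    pderiv (.heis 0 0) (expCre κ a n : Fock m) = (a * κ) • expCre κ a (n - 1) := by
  rcases lt_or_ge n 0 with h | h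
  · rw [expCre_of_neg _ _ h, expCre_of_neg _ _ (by omega), map_zero, smul_zero]
  · lift n to ℕ using h
    have h0 : powerDeriv (pderiv (.heis 0 0)) (phiCre κ a : PowerSeries (Fock m)) =
        (a * κ) • PowerSeries.X := by
      ext1 j
      rw [coeff_powerDeriv, phiCre, PowerSeries.coeff_mk, PowerSeries.coeff_smul,
        PowerSeries.coeff_X]
      split_ifs with h1 h2 h2
      · omega
      · simp
      · subst h2
        rw [Derivation.map_smul, pderiv_X_self, Nat.cast_one, div_one]
      · rw [Derivation.map_smul, pderiv_X_of_ne, smul_zero, smul_zero]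
        simp only [ne_eq, Osc.heis.injEq, true_and]
        omega
    rw [expCre_natCast, ← coeff_powerDeriv, powerDeriv_expSeries _ (constantCoeff_phiCre κ a), h0,
      smul_mul_assoc, PowerSeries.coeff_smul]
    rcases n with _ | n
    · rw [PowerSeries.coeff_zero_X_mul, expCre_of_neg _ _ (by simp)]
    · rw [PowerSeries.coeff_succ_X_mul, ← expCre_natCast]
      simp

lemma constantCoeff_expCre (κ a : ℂ) (n : ℤ) :
    constantCoeff (expCre κ a n : Fock m) = if n = 0 then 1 else 0 := by
  rcases lt_or_ge n 0 with h | h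
  · rw [expCre_of_neg _ _ h, if_neg (by omega), map_zero]
  · lift n to ℕ using h
    let τ : Fock m →ₐ[ℂ] ℂ := aeval 0
    have hτ : ∀ v : Fock m, constantCoeff v = τ v := fun v => by simp [τ]
    have h0 : PowerSeries.map (τ : Fock m →+* ℂ) (phiCre κ a) = 0 := by
      ext j
      rw [PowerSeries.coeff_map, phiCre, PowerSeries.coeff_mk]
      split_ifs
      · simp
      · simp [τ]
    rw [hτ, expCre_natCast]
    have := congrArg (PowerSeries.coeff n) (map_expSeries τ (phiCre κ a))
    rw [PowerSeries.coeff_map, h0] at this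
    refine this.trans ?_
    rw [expSeries, PowerSeries.coeff_mk, Finset.sum_range_succ']
    simp [PowerSeries.coeff_one]

lemma exists_expAnn_X (κ a : ℂ) (y : Osc m) : ∃ (t : ℂ) (k : ℕ), expAnn κ a (X y) =
    Polynomial.C (X y) - t • (Polynomial.X ^ (k + 1) : Polynomial (Fock m)) := by
  cases y with
  | beta l n => exact ⟨0, 0, by simp [expAnn]⟩
  | gamma l n => exact ⟨0, 0, by simp [expAnn]⟩
  | heis l n =>
    by_cases h : l = 0
    · exact ⟨2 * a * κ, n, by simp [expAnn, h]⟩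
    · exact ⟨0, 0, by simp [expAnn, h]⟩

/-- The annihilation half is a translation of the variables by quantities independent of them, and
translations commute with partial derivatives. -/
lemma coeff_expAnn_pderiv (κ a : ℂ) (x : Osc m) (v : Fock m) (i : ℕ) :
    (expAnn κ a (pderiv x v)).coeff i = pderiv x ((expAnn κ a v).coeff i) := by
  induction v using MvPolynomial.induction_on generalizing i with
  | C c =>
    have : expAnn κ a (C c : Fock m) = Polynomial.C (C c) := by
      rw [← MvPolynomial.algebraMap_eq, AlgHom.commutes]; rfl
    rw [pderiv_C, map_zero, this, Polynomial.coeff_C]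
    split_ifs <;> simp
  | add p q hp hq => simp only [map_add, Polynomial.coeff_add, hp, hq]
  | mul_X p y hp =>
    obtain ⟨t, k, h⟩ := exists_expAnn_X κ a y
    have hXy : ∃ c : ℂ, pderiv x (X y : Fock m) = C c := by
      rw [pderiv_X]
      by_cases hxy : y = x
      · subst hxy; exact ⟨1, by simp⟩
      · exact ⟨0, by simp [hxy]⟩
    obtain ⟨c, hc⟩ := hXy
    have hC : expAnn κ a (C c : Fock m) = Polynomial.C (C c) := by
      rw [← MvPolynomial.algebraMap_eq, AlgHom.commutes]; rfl
    have key : ∀ (q : Fock m) (i : ℕ), (expAnn κ a (q * X y)).coeff i =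
        (expAnn κ a q).coeff i * X y -
          if k + 1 ≤ i then t • (expAnn κ a q).coeff (i - (k + 1)) else 0 := by
      intro q i
      rw [map_mul, h, mul_sub, Polynomial.coeff_sub, Polynomial.coeff_mul_C, mul_smul_comm,
        Polynomial.coeff_smul, Polynomial.coeff_mul_X_pow']
      split_ifs <;> simp
    rw [pderiv_mul, map_add, Polynomial.coeff_add, key, key, hc, map_mul, hC,
      Polynomial.coeff_mul_C,
      map_sub, pderiv_mul, hc, hp]
    split_ifs
    · rw [Derivation.map_smul, hp]; ring
    · rw [map_zero]; ring

lemma vertexExp_apply (κ a : ℂ) (n : ℤ) (v : Fock m) {N : ℕ} (hN : (expAnn κ a v).natDegree < N) :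
    (vertexExp κ a).1 n v =
      ∑ i ∈ Finset.range N, expCre κ a (n + i) * (expAnn κ a v).coeff i := by
  simp only [vertexExp, LinearMap.comp_apply, AlgHom.toLinearMap_apply, Polynomial.lsum_apply]
  exact Polynomial.sum_over_range' _ (fun _ => by simp) N hN

lemma vertexExp_one (κ a : ℂ) (n : ℤ) : (vertexExp κ a).1 n (1 : Fock m) = expCre κ a n := by
  rw [vertexExp_apply κ a n 1 (N := 1) (by simp)]
  simp

/-- Only the creation half fails to commute with the derivative. The relevant values are c = aκ for
b^(0)_(-1), and c = 0 for every oscillator outside b^(0). -/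
lemma pderiv_vertexExp (κ a c : ℂ) (x : Osc m)
    (h : ∀ n, pderiv x (expCre κ a n : Fock m) = c • expCre κ a (n - 1)) (n : ℤ) (v : Fock m) :
    pderiv x ((vertexExp κ a).1 n v) =
      (vertexExp κ a).1 n (pderiv x v) + c • (vertexExp κ a).1 (n - 1) v := by
  set N := (expAnn κ a v).natDegree + (expAnn κ a (pderiv x v)).natDegree + 1 with hN
  rw [vertexExp_apply κ a n v (N := N) (by omega), vertexExp_apply κ a (n - 1) v (N := N) (by
    omega),
    vertexExp_apply κ a n (pderiv x v) (N := N) (by omega), map_sum, Finset.smul_sum,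
    ← Finset.sum_add_distrib]
  refine Finset.sum_congr rfl fun i _ => ?_
  rw [pderiv_mul, h, coeff_expAnn_pderiv, smul_mul_assoc, add_comm,
    show n + i - 1 = n - 1 + (i : ℤ) by ring]

lemma pderiv_vertexExp_of_ne (κ a : ℂ) (x : Osc m) (hx : ∀ j, x ≠ .heis 0 j) (n : ℤ) (v : Fock m) :
    pderiv x ((vertexExp κ a).1 n v) = (vertexExp κ a).1 n (pderiv x v) := by
  simpa using pderiv_vertexExp κ a 0 x (fun n => by rw [pderiv_expCre_of_ne κ a x hx, zero_smul]) n
    v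

lemma constantCoeff_vertexExp (κ a : ℂ) (n : ℤ) (v : Fock m) :
    constantCoeff ((vertexExp κ a).1 n v) =
      if n ≤ 0 then constantCoeff ((expAnn κ a v).coeff (-n).toNat) else 0 := by
  set N := (expAnn κ a v).natDegree + (-n).toNat + 1 with hN
  rw [vertexExp_apply κ a n v (N := N) (by omega), map_sum]
  simp only [map_mul, constantCoeff_expCre]
  split_ifs with h
  · rw [Finset.sum_eq_single (-n).toNat]
    · rw [if_pos (by omega), one_mul]
    · intro i _ hi
      rw [if_neg (by omega), zero_mul]
    · intro h'
      exact absurd (Finset.mem_range.mpr (by omega)) h'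
  · exact Finset.sum_eq_zero fun i _ => by rw [if_neg (by omega), zero_mul]

/-- The creation part of the exponential. -/
def expCreSer (κ a : ℂ) : LaurentSeries (Fock m) := ser (vertexExp κ a)

@[simp]
lemma coeff_expCreSer (κ a : ℂ) (n : ℤ) :
    (expCreSer κ a : LaurentSeries (Fock m)).coeff n = expCre κ a n := vertexExp_one κ a n

lemma fockDeriv_expCreSer_of_ne (κ a : ℂ) (x : Osc m) (hx : ∀ j, x ≠ .heis 0 j) :
    fockDeriv x (expCreSer κ a) = 0 := by
  ext1
  funext n
  rw [coeff_coeffDeriv, coeff_expCreSer, pderiv_expCre_of_ne κ a x hx]; rfl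

lemma fockDeriv_heis_expCreSer (κ a : ℂ) :
    fockDeriv (.heis 0 0) (expCreSer κ a : LaurentSeries (Fock m)) =
      (a * κ) • (single 1 1 * expCreSer κ a) := by
  ext1
  funext n
  rw [coeff_coeffDeriv, coeff_expCreSer, pderiv_heis_expCre, HahnSeries.coeff_smul,
    coeff_single_mul,
    one_mul, coeff_expCreSer]

end VertexOperator

/-! ### Derivatives across normally ordered products, and vacuum coefficients. -/

section Commutation

open MvPolynomial

variable {V : Type} [AddCommGroup V] [Module ℂ V]

/-- A Leibniz rule: `t` and `i₀` record the single mode of `a` which fails to commute with `D`,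
while `t'` and `k` record the shift picked up by `A`. With `t = 0` the shift passes through the
product unchanged; with `t' = 0` the letter is stripped off. -/
lemma nprod_commutator (D : Module.End ℂ V) (a : FreeField V) (A : QField V) (t t' : ℂ) (i₀ k : ℤ)
    (hc : ∀ i v, D (a.cre i v) = a.cre i (D v) + if i = i₀ then t • v else 0)
    (ha : ∀ i v, D (a.ann i v) = a.ann i (D v))
    (hA : ∀ n v, D (A.1 n v) = A.1 n (D v) + t' • A.1 (n - k) v) (n : ℤ) (v : V) :
    D ((nprod a A).1 n v) =
      (nprod a A).1 n (D v) + t' • (nprod a A).1 (n - k) v + t • A.1 (n - i₀) v := by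
  have hsplit : (Function.support fun i : ℤ => if i = i₀ then t • A.1 (n - i) v else 0).Finite :=
    (Set.finite_singleton i₀).subset fun i hi => by
      by_contra h
      exact hi (if_neg h)
  have h1 : ∀ i, D (a.cre i (A.1 (n - i) v)) = a.cre i (A.1 (n - i) (D v)) +
      t' • a.cre i (A.1 (n - k - i) v) + if i = i₀ then t • A.1 (n - i) v else 0 := by
    intro i
    rw [hc, hA, map_add, map_smul, sub_right_comm]
  have h2 : ∀ i, D (A.1 (n - i) (a.ann i v)) = A.1 (n - i) (a.ann i (D v)) +
      t' • A.1 (n - k - i) (a.ann i v) := by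
    intro i
    rw [hA, ha, sub_right_comm]
  have hs : ∀ f : ℤ → V, (Function.support f).Finite →
      (Function.support fun i => t' • f i).Finite := fun f hf =>
    hf.subset fun i hi h => hi (by simp [h])
  simp only [nprod_apply]
  rw [map_add, map_finsum D (cre_support a A n v), map_finsum D (ann_support a A n v),
    finsum_congr h1, finsum_congr h2,
    finsum_add_distrib (((cre_support a A n (D v)).union (hs _ (cre_support a A (n - k) v))).subset
      (Function.support_add _ _)) hsplit,
    finsum_add_distrib (cre_support a A n (D v)) (hs _ (cre_support a A (n - k) v)),
    finsum_add_distrib (ann_support a A n (D v)) (hs _ (ann_support a A (n - k) v)),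
    ← smul_finsum' t' (cre_support a A (n - k) v), ← smul_finsum' t' (ann_support a A (n - k) v),
    finsum_eq_single _ i₀ (fun i hi => if_neg hi), if_pos rfl]
  module

variable {m : ℕ}

lemma pderiv_letterField_ann (ε : ℂ) (b : Gen m × ℕ) (x : Osc m) (i : ℤ) (v : Fock m) :
    pderiv x ((letterField ε b).ann i v) = (letterField ε b).ann i (pderiv x v) := by
  obtain ⟨c, y, h⟩ := letterField_ann_eq_smul ε b i
  rw [h]
  simp only [LinearMap.smul_apply, Derivation.map_smul]
  exact congrArg _ (pderiv_pderiv x y v)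

lemma pderiv_letterField_cre (ε : ℂ) (b : Gen m × ℕ) (x : Osc m) (i : ℤ) (v : Fock m) :
    pderiv x ((letterField ε b).cre i v) =
      (letterField ε b).cre i (pderiv x v) + (fockDeriv x (creSer ε b)).coeff i * v := by
  rw [letterField_cre_apply, letterField_cre_apply, pderiv_mul, coeff_coeffDeriv, add_comm]

lemma nord_cons (ε : ℂ) (b : Gen m × ℕ) (L : List (Gen m × ℕ)) (B : QField (Fock m)) :
    nord ε (b :: L) B = nprod (letterField ε b) (nord ε L B) := rfl

/-- A derivative that does not meet the letters of `L` commutes with a normally ordered product up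
to the same shift as with its last factor. -/
lemma pderiv_nord (ε : ℂ) (L : List (Gen m × ℕ)) (B : QField (Fock m)) (x : Osc m)
    (hL : ∀ b ∈ L, ∀ n, x ≠ oscOf b.1 n) (t : ℂ)
    (hB : ∀ n v, pderiv x (B.1 n v) = B.1 n (pderiv x v) + t • B.1 (n - 1) v) (n : ℤ) (v : Fock m) :
    pderiv x ((nord ε L B).1 n v) =
      (nord ε L B).1 n (pderiv x v) + t • (nord ε L B).1 (n - 1) v := by
  induction L generalizing n v with
  | nil => exact hB n v
  | cons b L ih =>
    have := nprod_commutator (pderiv x).toLinearMap (letterField ε b) (nord ε L B) 0 t 0 1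
      (fun i v => by
        have := pderiv_letterField_cre ε b x i v
        rw [fockDeriv_creSer_of_ne ε b x (hL b List.mem_cons_self)] at this
        simpa using this)
      (fun i v => pderiv_letterField_ann ε b x i v)
      (fun n v => ih (fun b hb => hL b (List.mem_cons_of_mem _ hb)) n v) n v
    simpa [nord_cons] using this

lemma pderiv_nord_of_comm (ε : ℂ) (L : List (Gen m × ℕ)) (B : QField (Fock m)) (x : Osc m)
    (hL : ∀ b ∈ L, ∀ n, x ≠ oscOf b.1 n)
    (hB : ∀ n v, pderiv x (B.1 n v) = B.1 n (pderiv x v)) (n : ℤ) (v : Fock m) :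
    pderiv x ((nord ε L B).1 n v) = (nord ε L B).1 n (pderiv x v) := by
  simpa using pderiv_nord ε L B x hL 0 (by simpa using hB) n v

/-- The coefficient of the vacuum. -/
def vacCoeff : Fock m →ₗ[ℂ] ℂ := (aeval (0 : Osc m → ℂ)).toLinearMap

lemma vacCoeff_apply (v : Fock m) : vacCoeff v = constantCoeff v := by simp [vacCoeff]

/-- A creation operator multiplies by something without constant term, so the vacuum coefficient
sees the annihilation half alone. -/
lemma vacCoeff_nprod (ε : ℂ) (b : Gen m × ℕ) (A : QField (Fock m)) (n : ℤ) (v : Fock m) :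
    vacCoeff ((nprod (letterField ε b) A).1 n v) =
      ∑ᶠ i : ℤ, vacCoeff (A.1 (n - i) ((letterField ε b).ann i v)) := by
  have h : ∀ i w, vacCoeff ((letterField ε b).cre i w) = 0 := by
    intro i w
    rw [letterField_cre_apply, vacCoeff_apply, map_mul, coeff_creSer]
    split_ifs <;> simp [smul_eq_C_mul]
  rw [nprod_apply, map_add, map_finsum _ (cre_support _ A n v), map_finsum _ (ann_support _ A n v)]
  simp only [h, finsum_zero, zero_add]

end Commutation

/-! ### Wick contraction of raising with lowering fields. -/

section Contraction

open MvPolynomial HahnSeries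

/-- The variable of the Laurent series ring. -/
abbrev lvar : LaurentSeries ℂ := single 1 1

/-- The power series that are rational multiples of `(1 - ω X)^(-θ)`, with poles only at `ω⁻¹`. -/
def IsBinomMultiple (θ : ℂ) (f : PowerSeries (LaurentSeries ℂ)) : Prop :=
  ∃ r, IsPolarAt lvar r ∧ f = r * binomSeriesAt HahnSeries.C lvar θ

namespace IsBinomMultiple

variable {θ : ℂ} {f g : PowerSeries (LaurentSeries ℂ)}

lemma zero : IsBinomMultiple θ 0 := ⟨0, .zero, by simp⟩

lemma add (hf : IsBinomMultiple θ f) (hg : IsBinomMultiple θ g) : IsBinomMultiple θ (f + g) := by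
  obtain ⟨r, hr, rfl⟩ := hf
  obtain ⟨t, ht, rfl⟩ := hg
  exact ⟨r + t, hr.add ht, by ring⟩

lemma polar_mul (hf : IsPolarAt lvar f) (hg : IsBinomMultiple θ g) : IsBinomMultiple θ (f * g) := by
  obtain ⟨r, hr, rfl⟩ := hg
  exact ⟨f * r, hf.mul hr, by ring⟩

end IsBinomMultiple

lemma lvar_pow (n : ℕ) : lvar ^ n = single (n : ℤ) 1 := by
  rw [single_pow, one_pow]
  simp

/-- A series `∑ q(j) w^(j + k) X^j`, up to finitely many terms, is rational. -/
lemma isPolarAt_of_coeff {f : PowerSeries (LaurentSeries ℂ)} (q : Polynomial ℂ) (k : ℤ) (N : ℕ)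
    (h : ∀ j, N ≤ j → PowerSeries.coeff j f = q.eval (j : ℂ) • single ((j : ℤ) + k) 1) :
    IsPolarAt lvar f := by
  refine ((IsPolarAt.const (single k 1)).mul
    (IsPolarAt.mk_eval lvar (q.map (HahnSeries.C : ℂ →+* LaurentSeries ℂ)))).congr N fun j hj => ?_
  have : (q.map (HahnSeries.C : ℂ →+* LaurentSeries ℂ)).eval (j : LaurentSeries ℂ) =
      HahnSeries.C (q.eval (j : ℂ)) := by
    rw [← map_natCast (HahnSeries.C : ℂ →+* LaurentSeries ℂ), Polynomial.eval_map_apply]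
  rw [h j hj, PowerSeries.coeff_C_mul, PowerSeries.coeff_mk, this, lvar_pow, mul_left_comm,
    single_mul_single, one_mul, C_mul_eq_smul, add_comm]

variable {m : ℕ}

/-- A family of functionals, applied to a series with coefficients in the Fock space. -/
def hat (Ψ : ℕ → Fock m →ₗ[ℂ] ℂ) : LaurentSeries (Fock m) →+ PowerSeries (LaurentSeries ℂ) where
  toFun u := PowerSeries.mk fun j => coeffMap (Ψ j) u
  map_zero' := by ext1; simp
  map_add' u v := by ext1; simp

@[simp]
lemma coeff_hat (Ψ : ℕ → Fock m →ₗ[ℂ] ℂ) (u : LaurentSeries (Fock m)) (j : ℕ) :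
    PowerSeries.coeff j (hat Ψ u) = coeffMap (Ψ j) u := by
  change PowerSeries.coeff j (PowerSeries.mk fun j => coeffMap (Ψ j) u) = _
  simp

lemma coeffMap_smul_single_mul (f : Fock m →ₗ[ℂ] ℂ) (c : ℂ) (k : ℤ) (u : LaurentSeries (Fock m)) :
    coeffMap f (c • single k 1 * u) = (c • single k 1) * coeffMap f u := by
  rw [smul_mul_assoc, map_smul, coeffMap_single_mul, ← C_mul_eq_smul, ← C_mul_eq_smul, mul_assoc]

lemma coeffMap_smul_smul_single_mul (f : Fock m →ₗ[ℂ] ℂ) (c t : ℂ) (k : ℤ)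
    (u : LaurentSeries (Fock m)) :
    coeffMap f (c • (t • single k 1 * u)) = (c • (t • single k 1)) * coeffMap f u := by
  rw [← smul_mul_assoc, smul_smul, smul_smul, coeffMap_smul_single_mul]

lemma hat_smul_single_mul (Ψ : ℕ → Fock m →ₗ[ℂ] ℂ) (c : ℂ) (k : ℤ) (u : LaurentSeries (Fock m)) :
    hat Ψ (c • single k 1 * u) = PowerSeries.C (c • single k 1) * hat Ψ u := by
  ext1 j
  rw [PowerSeries.coeff_C_mul, coeff_hat, coeff_hat, coeffMap_smul_single_mul]

lemma hat_mul (Ψ : ℕ → Fock m →ₗ[ℂ] ℂ)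
    (h : ∀ j u v, Ψ j (u * v) = ∑ p ∈ Finset.HasAntidiagonal.antidiagonal j, Ψ p.1 u * Ψ p.2 v)
    (u v : LaurentSeries (Fock m)) : hat Ψ (u * v) = hat Ψ u * hat Ψ v := by
  ext1 j
  ext1
  funext n
  have hs : ∀ (i : ℕ) (u : LaurentSeries (Fock m)), (coeffMap (Ψ i) u).support ⊆ u.support := by
    intro i u k hk hk'
    exact hk (by rw [coeff_coeffMap, show u.coeff k = 0 from hk', map_zero])
  rw [PowerSeries.coeff_mul, coeff_hat, coeff_coeffMap, HahnSeries.coeff_mul, map_sum]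
  simp only [h, coeff_hat]
  rw [Finset.sum_comm, ← coeff.addMonoidHom_apply, map_sum]
  refine Finset.sum_congr rfl fun p _ => ?_
  rw [coeff.addMonoidHom_apply, coeff_mul_left' u.isPWO_support (hs p.1 u)]
  refine (Finset.sum_subset ?_ ?_).symm
  · intro x hx
    rw [Finset.mem_antidiagonal] at hx ⊢
    exact ⟨hx.1, hs _ _ hx.2.1, hx.2.2⟩
  · intro x hx hx'
    rw [Finset.mem_antidiagonal] at hx hx'
    have : (coeffMap (Ψ p.2) v).coeff x.2 = 0 := by
      by_contra h0
      exact hx' ⟨hx.1, h0, hx.2.2⟩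
    rw [coeff_coeffMap] at this
    rw [this, mul_zero]

/-- The annihilation part of a ghost letter. -/
lemma exists_letterField_ann (ε : ℂ) (l : Fin m) (b : Gen m × ℕ)
    (hb : b.1 = .beta l ∨ b.1 = .gamma l) :
    ∃ (g : Gen m) (N : ℕ) (p : Polynomial ℂ), (g = .beta l ∨ g = .gamma l) ∧
      (∀ i : ℤ, -N < i → (letterField ε b).ann i = 0) ∧
      ∀ q : ℕ, N ≤ q → (letterField ε b).ann (-q) = p.eval (q : ℂ) • annih (oscOf g (q - N)) := by
  obtain ⟨g, d⟩ := b
  have hneg : ∀ q : ℕ, ((derivPoly d).comp (-Polynomial.X)).eval (q : ℂ) =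
      (derivPoly d).eval ((-q : ℤ) : ℂ) := by
    intro q; simp
  rcases hb with rfl | rfl
  -- The first annihilation mode of β is β_1, at z^(-2), and d derivatives move it to z^(-d-2). For
  -- γ it is γ_0 at z^0, hence the value `d` in the other case.
  · refine ⟨.gamma l, d + 2, Polynomial.C (-ε) * (derivPoly d).comp (-Polynomial.X), .inr rfl, ?_,
      ?_⟩
    · intro i hi
      rw [letterField, (iterate_deriv_modes _ _ _).2]
      have : (genField ε (.beta l)).ann (i + d) = 0 := by
        refine if_neg ?_
        simp only [IsAnn, modeIndex]
        push_cast at hi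
        omega
      rw [this, smul_zero]
    · intro q hq
      rw [letterField, (iterate_deriv_modes _ _ _).2]
      have : (genField ε (.beta l)).ann (-(q : ℤ) + d) = (-ε) • annih (.gamma l (q - (d + 2))) := by
        refine (if_pos ?_).trans ?_
        · simp only [IsAnn, modeIndex]; omega
        · refine (if_neg ?_).trans ?_
          · simp only [modeIndex]; omega
          · simp only [modeIndex]
            congr 3
            omega
      rw [this, smul_smul, Polynomial.eval_mul, Polynomial.eval_C, hneg, mul_comm]
      rfl
  · refine ⟨.beta l, d, Polynomial.C ε * (derivPoly d).comp (-Polynomial.X), .inl rfl, ?_, ?_⟩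
    · intro i hi
      rw [letterField, (iterate_deriv_modes _ _ _).2]
      have : (genField ε (.gamma l)).ann (i + d) = 0 := by
        refine if_neg ?_
        simp only [IsAnn, modeIndex]
        omega
      rw [this, smul_zero]
    · intro q hq
      rw [letterField, (iterate_deriv_modes _ _ _).2]
      have : (genField ε (.gamma l)).ann (-(q : ℤ) + d) = ε • annih (.beta l (q - d)) := by
        refine (if_pos ?_).trans ?_
        · simp only [IsAnn, modeIndex]; omega
        · refine (if_neg ?_).trans ?_
          · simp only [modeIndex]; omega
          · simp only [modeIndex]
            congr 3
            omega
      rw [this, smul_smul, Polynomial.eval_mul, Polynomial.eval_C, hneg, mul_comm]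
      rfl

variable [NeZero m]

/-- The vacuum coefficient of the coefficient of `z^(-j)` of a raising field. -/
def modeFun (ε κ a : ℂ) (L : List (Gen m × ℕ)) (j : ℕ) : Fock m →ₗ[ℂ] ℂ :=
  vacCoeff ∘ₗ (nord ε L (vertexExp κ a)).1 (-j)

lemma modeFun_nil (ε κ a : ℂ) (j : ℕ) (v : Fock m) :
    modeFun ε κ a [] j v = constantCoeff ((expAnn κ a v).coeff j) := by
  rw [modeFun, LinearMap.comp_apply, vacCoeff_apply]
  refine (constantCoeff_vertexExp κ a (-j) v).trans ?_
  rw [if_pos (by omega)]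
  simp

/-- For a bare exponential, contraction is multiplicative: a translation followed by evaluation at
the vacuum is an algebra homomorphism. The outer variable X stands for z⁻¹, the coefficients are
Laurent series in w. -/
lemma hat_modeFun_nil_mul (ε κ a : ℂ) (u v : LaurentSeries (Fock m)) :
    hat (modeFun ε κ a []) (u * v) = hat (modeFun ε κ a []) u * hat (modeFun ε κ a []) v := by
  refine hat_mul _ (fun j u v => ?_) u v
  simp only [modeFun_nil]
  rw [map_mul, Polynomial.coeff_mul, map_sum]
  simp

/-- Only b^(0) and its derivatives contract with the exponential. Each b^(0)_(-j) is replaced by a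
constant times z^(-j), which gives a geometric series in w/z with polynomial coefficients. -/
lemma isPolarAt_hat_creSer (ε κ a : ℂ) (b : Gen m × ℕ) :
    IsPolarAt lvar (hat (modeFun ε κ a []) (creSer ε b)) := by
  by_cases hb : b.1 = .heis 0
  · obtain ⟨g, d⟩ := b
    obtain rfl : g = .heis 0 := hb
    refine isPolarAt_of_coeff (Polynomial.C (-(2 * a * κ)) *
      (derivPoly d).comp (Polynomial.X - Polynomial.C (1 + (d : ℂ)))) (-1 - d) 1 fun j hj => ?_
    ext1
    funext n
    rw [coeff_hat, coeff_coeffMap, modeFun_nil, coeff_creSer, HahnSeries.coeff_smul]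
    simp only [lowExp, oscOf, sub_zero]
    split_ifs with hn
    · have hX : expAnn κ a (X (Osc.heis 0 (n + d).toNat) : Fock m) =
          Polynomial.C (X (Osc.heis 0 (n + d).toNat)) -
            (2 * a * κ) • Polynomial.X ^ ((n + d).toNat + 1) := by
        simp [expAnn]
      rw [map_smul, hX, Polynomial.coeff_smul, Polynomial.coeff_sub, Polynomial.coeff_C,
        if_neg (by omega), zero_sub, Polynomial.coeff_smul, Polynomial.coeff_X_pow]
      by_cases hjn : n = j + (-1 - d)
      · subst hjn
        rw [if_pos (by omega), coeff_single_same]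
        simp [smul_eq_C_mul, sub_eq_add_neg]
        ring_nf
      · rw [if_neg (by omega), coeff_single_of_ne hjn]
        simp
    · rw [coeff_single_of_ne (by omega)]
      simp
  · have : hat (modeFun ε κ a []) (creSer ε b) = 0 := by
      ext1 j
      ext1
      funext n
      rw [coeff_hat, coeff_coeffMap, modeFun_nil, coeff_creSer]
      have hX : ∀ k, expAnn κ a (X (oscOf b.1 k) : Fock m) = Polynomial.C (X (oscOf b.1 k)) := by
        intro k
        obtain ⟨g, d⟩ := b
        cases g with
        | beta l => simp [oscOf, expAnn]
        | gamma l => simp [oscOf, expAnn]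
        | heis l =>
          have : l ≠ 0 := fun h => hb (by rw [h])
          simp [oscOf, expAnn, this]
      split_ifs
      · rw [map_smul, hX, Polynomial.coeff_smul, Polynomial.coeff_C]
        split_ifs <;> simp [smul_eq_C_mul]
      · simp
    rw [this]
    exact .zero

/-- The source of the branching. The translation replaces b^(0)_(-j) by -2aκ z^(-j), so b φ_cre(w)
becomes -2abκ² ∑ (w/z)^j / j, and its exponential is (1 - w/z)^(2abκ²). -/
lemma hat_expCreSer (ε κ a b : ℂ) :
    hat (modeFun ε κ a []) (expCreSer κ b : LaurentSeries (Fock m)) =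
      binomSeriesAt HahnSeries.C lvar (-(2 * a * b * κ ^ 2)) := by
  ext1 j
  ext1
  funext n
  rw [coeff_hat, coeff_coeffMap, modeFun_nil, coeff_expCreSer, binomSeriesAt, PowerSeries.coeff_mk,
    lvar_pow, C_mul_eq_smul, HahnSeries.coeff_smul]
  rcases lt_or_ge n 0 with h | h
  · rw [expCre_of_neg _ _ h, coeff_single_of_ne (by omega)]
    simp
  lift n to ℕ using h
  let π : Polynomial (Fock m) →ₐ[ℂ] Polynomial ℂ := Polynomial.mapAlgHom (aeval (0 : Osc m → ℂ))
  let τ : Fock m →ₐ[ℂ] Polynomial ℂ := π.comp (expAnn κ a)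
  have hτ : ∀ v, constantCoeff ((expAnn κ a v).coeff j) = (τ v).coeff j := by
    intro v
    simp [τ, π]
  -- Every oscillator of index j goes to a multiple of y^j with y = z⁻¹. The image depends on w and
  -- y only through the product wy, expressed here by rescaling.
  have hphi : PowerSeries.map (τ : Fock m →+* Polynomial ℂ) (phiCre κ b) =
      PowerSeries.rescale Polynomial.X (PowerSeries.map (Algebra.ofId ℂ (Polynomial ℂ) : ℂ →+*
        Polynomial ℂ)
        (PowerSeries.mk fun j => -(2 * a * b * κ ^ 2) / (j : ℂ))) := by
    ext1 i
    rw [PowerSeries.coeff_map, phiCre, PowerSeries.coeff_mk, PowerSeries.coeff_rescale,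
      PowerSeries.coeff_map, PowerSeries.coeff_mk]
    rcases i with _ | i
    · simp
    · have hX : τ (X (Osc.heis 0 i)) = -((2 * a * κ) • Polynomial.X ^ (i + 1)) := by
        rw [show τ (X (Osc.heis 0 i)) = π (expAnn κ a (X (Osc.heis 0 i))) from rfl,
          show expAnn κ a (X (Osc.heis 0 i) : Fock m) = Polynomial.C (X (Osc.heis 0 i)) -
            (2 * a * κ) • Polynomial.X ^ (i + 1) by simp [expAnn], map_sub, map_smul]
        simp [π]
      rw [if_neg (Nat.succ_ne_zero i), RingHom.coe_coe, map_smul, Nat.add_sub_cancel, hX]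
      change _ = Polynomial.X ^ (i + 1) * Polynomial.C _
      rw [mul_comm (Polynomial.X ^ (i + 1)), ← Polynomial.smul_eq_C_mul, ← neg_smul, smul_smul]
      congr 1
      ring
  have h1 := congrArg (PowerSeries.coeff n) (map_expSeries τ (phiCre κ b))
  rw [hphi, ← rescale_expSeries, ← map_expSeries, PowerSeries.coeff_map, PowerSeries.coeff_rescale,
    PowerSeries.coeff_map] at h1
  rw [hτ, expCre_natCast]
  refine (congrArg (fun p : Polynomial ℂ => p.coeff j) h1).trans ?_
  change (Polynomial.X ^ n * Polynomial.C (PowerSeries.coeff n (binomSeries _))).coeff j = _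
  rw [mul_comm, Polynomial.coeff_C_mul, Polynomial.coeff_X_pow, HahnSeries.coeff_single]
  by_cases hjn : j = n
  · subst hjn; simp
  · rw [if_neg hjn, if_neg (by omega)]; simp

lemma isBinomMultiple_hat_nil (ε κ a b : ℂ) (L : List (Gen m × ℕ)) :
    IsBinomMultiple (-(2 * a * b * κ ^ 2)) (hat (modeFun ε κ a [])
      (creProd ε L * expCreSer κ b)) := by
  induction L with
  | nil =>
    refine ⟨1, ?_, ?_⟩
    · simpa using IsPolarAt.const (ω := lvar) 1
    · rw [creProd_nil, one_mul, one_mul, hat_expCreSer]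
  | cons c L ih =>
    rw [creProd_cons, mul_assoc (creSer ε c), hat_modeFun_nil_mul]
    exact .polar_mul (isPolarAt_hat_creSer ε κ a c) ih

/-- Annihilation parts of ghost letters carry no positive power of z, and neither does the vacuum
coefficient of the exponential. This bounds the convolution in `modeFun_cons`. -/
lemma vacCoeff_nord_of_pos (ε κ a : ℂ) (l : Fin m) (L : List (Gen m × ℕ))
    (hL : ∀ b ∈ L, b.1 = .beta l ∨ b.1 = .gamma l) (n : ℤ) (hn : 0 < n) (v : Fock m) :
    vacCoeff ((nord ε L (vertexExp κ a)).1 n v) = 0 := by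
  induction L generalizing n v with
  | nil =>
    rw [vacCoeff_apply]
    exact (constantCoeff_vertexExp κ a n v).trans (if_neg (by omega))
  | cons b L ih =>
    obtain ⟨g, N, p, -, h0, -⟩ := exists_letterField_ann ε l b (hL b List.mem_cons_self)
    rw [nord_cons, vacCoeff_nprod]
    refine finsum_eq_zero_of_forall_eq_zero fun i => ?_
    by_cases hi : -N < i
    · rw [h0 i hi, LinearMap.zero_apply, map_zero, map_zero]
    · exact ih (fun b hb => hL b (List.mem_cons_of_mem _ hb)) _ (by omega) _

lemma modeFun_cons (ε κ a : ℂ) (l : Fin m) (b : Gen m × ℕ) (L : List (Gen m × ℕ))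
    (hb : b.1 = .beta l ∨ b.1 = .gamma l)
    (hL : ∀ b ∈ L, b.1 = .beta l ∨ b.1 = .gamma l) (j : ℕ) (v : Fock m) :
    modeFun ε κ a (b :: L) j v =
      ∑ p ∈ Finset.HasAntidiagonal.antidiagonal j, modeFun ε κ a L p.2 ((letterField ε b).ann
        (-p.1) v) := by
  obtain ⟨g, N, p, -, h0, -⟩ := exists_letterField_ann ε l b hb
  rw [modeFun, LinearMap.comp_apply, nord_cons, vacCoeff_nprod,
    Finset.Nat.sum_antidiagonal_eq_sum_range_succ_mk,
    finsum_eq_sum_of_support_subset (s := (Finset.range (j + 1)).image fun q : ℕ => -(q : ℤ)),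
    Finset.sum_image (fun x _ y _ h => by simpa using h)]
  · refine Finset.sum_congr rfl fun q hq => ?_
    have hq : q ≤ j := by simpa [Nat.lt_succ_iff] using hq
    rw [modeFun, LinearMap.comp_apply, show -(j : ℤ) - -(q : ℤ) = -((j - q : ℕ) : ℤ) by omega]
  · intro i hi
    by_contra h
    apply hi
    by_cases hi0 : -N < i
    · simp only [h0 i hi0, LinearMap.zero_apply, map_zero]
    · refine vacCoeff_nord_of_pos ε κ a l L hL _ ?_ _
      by_contra h'
      apply h
      simp only [Finset.coe_image, Set.mem_image, Finset.mem_coe, Finset.mem_range]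
      exact ⟨(-i).toNat, by omega, by omega⟩

/-- The contraction of a family of derivations with a product of creation parts. -/
lemma isBinomMultiple_contraction (ε κ b θ : ℂ) (Ψ : ℕ → Fock m →ₗ[ℂ] ℂ)
    (hΨ : ∀ L, IsBinomMultiple θ (hat Ψ (creProd ε L * expCreSer κ b)))
    (g : Gen m) (hg : ∀ l, g ≠ .heis l) (N : ℕ) (p : Polynomial ℂ) (M L : List (Gen m × ℕ)) :
    IsBinomMultiple θ (PowerSeries.mk fun j => ∑ x ∈ Finset.HasAntidiagonal.antidiagonal j,
      if N ≤ x.1 then coeffMap (Ψ x.2) (p.eval (x.1 : ℂ) • (creProd ε M *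
        fockDeriv (oscOf g (x.1 - N)) (creProd ε L * expCreSer κ b))) else 0) := by
  have hexp : ∀ k, fockDeriv (oscOf g k) (expCreSer κ b : LaurentSeries (Fock m)) = 0 := by
    intro k
    refine fockDeriv_expCreSer_of_ne κ b _ fun j h => ?_
    exact hg 0 (oscOf_inj (g' := .heis 0).mp h).1
  induction L generalizing M with
  | nil =>
    convert IsBinomMultiple.zero using 1
    ext1 j
    simp [hexp]
  | cons c L ih =>
    -- The term of the Leibniz rule in which the derivation hits the head letter: the contraction of
    -- two letters is rational, and the remaining letters are covered by the hypothesis on `Ψ`.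
    have h1 : IsBinomMultiple θ ((PowerSeries.mk fun q => if N ≤ q then
        p.eval (q : ℂ) • coeffMap vacCoeff (fockDeriv (oscOf g (q - N)) (creSer ε c)) else 0) *
          hat Ψ (creProd ε (M ++ L) * expCreSer κ b)) := by
      refine .polar_mul ?_ (hΨ _)
      by_cases hgc : g = c.1
      · subst hgc
        refine isPolarAt_of_coeff (p * (derivPoly c.2).comp
          (Polynomial.X + Polynomial.C ((lowExp c.1 - c.2 - N : ℤ) : ℂ)))
          (lowExp c.1 - c.2 - N : ℤ) N fun j hj => ?_
        rw [PowerSeries.coeff_mk, if_pos hj, fockDeriv_creSer_self, map_smul, smul_smul,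
          ← mul_one (single _ (1 : Fock m)), coeffMap_single_mul,
          show coeffMap vacCoeff (1 : LaurentSeries (Fock m)) = 1 from ?_, mul_one,
          show ((j - N : ℕ) : ℤ) + lowExp c.1 - c.2 = j + (lowExp c.1 - c.2 - N) by omega]
        · simp
        · ext1; funext n
          rw [coeff_coeffMap, HahnSeries.coeff_one, HahnSeries.coeff_one]
          split_ifs <;> simp [vacCoeff_apply]
      · convert IsPolarAt.zero using 1
        ext1 j
        rw [PowerSeries.coeff_mk, fockDeriv_creSer_of_ne]
        · simp
        · intro n h
          exact hgc (oscOf_inj.mp h).1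
    -- In the other Leibniz term the head letter is a spectator; it joins `M`, which is why `M` is
    -- general in the induction.
    convert h1.add (ih (c :: M)) using 1
    ext1 j
    rw [map_add, PowerSeries.coeff_mk, PowerSeries.coeff_mul, PowerSeries.coeff_mk,
      ← Finset.sum_add_distrib]
    refine Finset.sum_congr rfl fun x _ => ?_
    rw [PowerSeries.coeff_mk]
    split_ifs with hx
    · obtain ⟨t, k, htk⟩ := exists_fockDeriv_creSer ε c (oscOf g (x.1 - N))
      have hv : coeffMap vacCoeff (t • single k 1 : LaurentSeries (Fock m)) = t • single k 1 := by
        ext1; funext n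
        rw [coeff_coeffMap, HahnSeries.coeff_smul, HahnSeries.coeff_smul, HahnSeries.coeff_single,
          HahnSeries.coeff_single]
        split_ifs <;> simp [vacCoeff_apply]
      rw [creProd_cons, mul_assoc (creSer ε c), Derivation.leibniz, htk, hv, coeff_hat,
        ← coeffMap_smul_smul_single_mul, ← LinearMap.map_add, ← smul_add, creProd_append,
          creProd_cons]
      congr 2
      simp only [smul_eq_mul]
      ring_nf
    · simp

/-- The functionals of a raising field, applied to the creation part of a lowering monomial. -/
lemma isBinomMultiple_hat (ε κ a b : ℂ) (l : Fin m) (L₁ : List (Gen m × ℕ))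
    (hL₁ : ∀ b ∈ L₁, b.1 = .beta l ∨ b.1 = .gamma l) (L : List (Gen m × ℕ)) :
    IsBinomMultiple (-(2 * a * b * κ ^ 2)) (hat (modeFun ε κ a L₁)
      (creProd ε L * expCreSer κ b)) := by
  induction L₁ generalizing L with
  | nil => exact isBinomMultiple_hat_nil ε κ a b L
  | cons c L₁ ih =>
    have hL : ∀ b ∈ L₁, b.1 = .beta l ∨ b.1 = .gamma l := fun b hb =>
      hL₁ b (List.mem_cons_of_mem _ hb)
    have hc := hL₁ c List.mem_cons_self
    obtain ⟨g, N, p, hg, h0, hN⟩ := exists_letterField_ann ε l c hc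
    have hg' : ∀ l, g ≠ .heis l := by rcases hg with rfl | rfl <;> simp
    convert isBinomMultiple_contraction ε κ b _ _ (ih hL) g hg' N p [] L using 1
    ext1 j
    ext1
    funext n
    rw [coeff_hat, coeff_coeffMap, modeFun_cons ε κ a l c L₁ hc hL, PowerSeries.coeff_mk,
      HahnSeries.coeff_sum]
    refine Finset.sum_congr rfl fun x _ => ?_
    split_ifs with hx
    · rw [coeff_coeffMap, HahnSeries.coeff_smul, creProd_nil, one_mul, coeff_coeffDeriv, hN x.1 hx]
      rfl
    · rw [h0 (-x.1) (by omega)]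
      simp

end Contraction

/-! ### Derivatives of the currents on the vacuum. -/

section VacuumSeries

open MvPolynomial HahnSeries

variable {m : ℕ}

lemma fockDeriv_single_mul (x : Osc m) (k : ℤ) (u : LaurentSeries (Fock m)) :
    fockDeriv x (single k 1 * u) = single k 1 * fockDeriv x u := by
  rw [Derivation.leibniz, coeffDeriv_single_one, smul_zero, add_zero, smul_eq_mul]

lemma fockDeriv_one (x : Osc m) : fockDeriv x 1 = 0 := Derivation.map_one_eq_zero _

lemma fockDeriv_beta_creSer (ε : ℂ) (l : Fin m) (k : ℕ) (g : Gen m) :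
    fockDeriv (.beta l k) (creSer ε (g, 0)) = if g = .beta l then single (k - 1 : ℤ) 1 else 0 := by
  split_ifs with h
  · subst h
    refine (fockDeriv_creSer_self ε (.beta l, 0) k).trans ?_
    simp [derivPoly, lowExp, sub_eq_add_neg]
  · exact fockDeriv_creSer_of_ne ε _ _ fun n hn => h (oscOf_inj (g := .beta l).mp hn).1.symm

lemma fockDeriv_gamma_creSer (ε : ℂ) (l : Fin m) (k : ℕ) (g : Gen m) :
    fockDeriv (.gamma l k) (creSer ε (g, 0)) = if g = .gamma l then single (k + 1 : ℤ) 1 else 0 :=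
      by
  split_ifs with h
  · subst h
    refine (fockDeriv_creSer_self ε (.gamma l, 0) k).trans ?_
    simp [derivPoly, lowExp]
  · exact fockDeriv_creSer_of_ne ε _ _ fun n hn => h (oscOf_inj (g := .gamma l).mp hn).1.symm

lemma fockDeriv_heis_creSer (ε : ℂ) (l : Fin m) (k : ℕ) (g : Gen m) :
    fockDeriv (.heis l k) (creSer ε (g, 0)) = if g = .heis l then single (k : ℤ) 1 else 0 := by
  split_ifs with h
  · subst h
    refine (fockDeriv_creSer_self ε (.heis l, 0) k).trans ?_
    simp [derivPoly, lowExp]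
  · exact fockDeriv_creSer_of_ne ε _ _ fun n hn => h (oscOf_inj (g := .heis l).mp hn).1.symm

lemma fockDeriv_creSer_gamma_one (ε : ℂ) (x : Osc m) (l : Fin m) (h : ∀ n, x ≠ .gamma l n) :
    fockDeriv x (creSer ε (.gamma l, 1)) = 0 := fockDeriv_creSer_of_ne ε _ x h

lemma ser_neg (A : QField (Fock m)) : ser (-A) = -ser A := by
  ext1
  funext n
  simp

lemma ser_sub (A B : QField (Fock m)) : ser (A - B) = ser A - ser B := by
  ext1
  funext n
  simp

variable [NeZero m]

lemma ser_vertexExp (κ a : ℂ) : ser (vertexExp κ a : QField (Fock m)) = expCreSer κ a := rfl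

lemma ser_hEven (ε s : ℂ) : ser (hEven m ε s) =
    (-2 : ℂ) • (creSer ε (.beta 0, 0) * creSer ε (.gamma 0, 0)) + s • creSer ε (.heis 0, 0) := by
  simp [hEven, ser_nord, ser_oneField]

lemma ser_hOdd (ε s : ℂ) (l : Fin m) : ser (hOdd ε s l) =
    -(creSer ε (.beta l, 0) * creSer ε (.gamma 0, 0)) -
      creSer ε (.beta 0, 0) * creSer ε (.gamma l, 0) + (s / 2) • creSer ε (.heis l, 0) := by
  simp [hOdd, ser_nord, ser_oneField, ser_neg, ser_sub]

lemma ser_fEven (ε s : ℂ) : ser (fEven m ε s) =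
    -(creSer ε (.beta 0, 0) * (creSer ε (.gamma 0, 0) * creSer ε (.gamma 0, 0))) +
      (s ^ 2 + 2) • creSer ε (.gamma 0, 1) +
      s • (creSer ε (.heis 0, 0) * creSer ε (.gamma 0, 0)) := by
  simp [fEven, ser_nord, ser_oneField, ser_neg]

lemma ser_fOdd (ε κ s : ℂ) (l : Fin m) : ser (fOdd ε κ s l) =
    -(creSer ε (.beta 0, 0) * (creSer ε (.gamma l, 0) * creSer ε (.gamma 0, 0)) *
        expCreSer κ (-s⁻¹)) +
      ((s ^ 2 + 2) / s ^ 2) • (creSer ε (.gamma l, 1) * expCreSer κ (-s⁻¹)) +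
      (s / 2) • (creSer ε (.heis l, 0) * creSer ε (.gamma l, 0) * expCreSer κ (-s⁻¹)) +
      s⁻¹ • (creSer ε (.heis 0, 0) * creSer ε (.gamma l, 0)) := by
  simp [fOdd, ser_nord, ser_oneField, ser_vertexExp, ser_neg]

lemma fockDeriv_gamma_beta_hOdd (ε s : ℂ) {l : Fin m} (hl : l ≠ 0) :
    fockDeriv (.gamma 0 0) (fockDeriv (.beta l 0) (ser (hOdd ε s l))) = -1 := by
  simp [ser_hOdd, fockDeriv_beta_creSer, fockDeriv_gamma_creSer, Derivation.leibniz,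
    coeffDeriv_single_one, hl.symm, single_mul_single, -single_zero_one]
  simp

lemma fockDeriv_gamma_beta_hEven (ε s : ℂ) :
    fockDeriv (.gamma 0 0) (fockDeriv (.beta 0 0) (ser (hEven m ε s))) = (-2 : ℂ) • 1 := by
  simp [ser_hEven, fockDeriv_beta_creSer, fockDeriv_gamma_creSer, Derivation.leibniz,
    coeffDeriv_single_one, single_mul_single]
  exact (neg_smul (2 : ℂ) (1 : LaurentSeries (Fock m))).symm

lemma fockDeriv_heis_hOdd (ε s : ℂ) {l : Fin m} :
    fockDeriv (.heis l 0) (ser (hOdd ε s l)) = (s / 2) • 1 := by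
  simp [ser_hOdd, fockDeriv_heis_creSer, Derivation.leibniz]

lemma fockDeriv_heis_zero_hOdd (ε s : ℂ) {l : Fin m} (hl : l ≠ 0) :
    fockDeriv (.heis 0 0) (ser (hOdd ε s l)) = 0 := by
  simp [ser_hOdd, fockDeriv_heis_creSer, Derivation.leibniz, hl]

lemma fockDeriv_heis_fEven (ε s : ℂ) {l : Fin m} (hl : l ≠ 0) :
    fockDeriv (.heis l 0) (ser (fEven m ε s)) = 0 := by
  simp [ser_fEven, fockDeriv_heis_creSer, Derivation.leibniz, hl.symm, fockDeriv_creSer_gamma_one]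

lemma fockDeriv_beta_fOdd (ε κ s : ℂ) {l l' : Fin m} (hl : l ≠ 0) :
    fockDeriv (.beta l 0) (ser (fOdd ε κ s l')) = 0 := by
  simp [ser_fOdd, fockDeriv_beta_creSer, Derivation.leibniz, hl.symm, fockDeriv_creSer_gamma_one,
    fockDeriv_expCreSer_of_ne]

/-- The pair of derivatives isolates the summand (√k/2) b^(l) γ^(l) exp(-αφ), leaving a bare
exponential; the extra power of w belongs to the first creation mode of γ. -/
lemma fockDeriv_gamma_heis_fOdd (ε κ s : ℂ) {l : Fin m} (hl : l ≠ 0) :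
    fockDeriv (.gamma l 0) (fockDeriv (.heis l 0) (ser (fOdd ε κ s l))) =
      (s / 2) • (single 1 1 * expCreSer κ (-s⁻¹)) := by
  simp [ser_fOdd, fockDeriv_heis_creSer, fockDeriv_gamma_creSer, Derivation.leibniz, hl,
    hl.symm, fockDeriv_creSer_gamma_one, fockDeriv_expCreSer_of_ne, mul_comm]

end VacuumSeries

/-! ### The derivative by b^(0)_(-1) and its twist. -/

section Nilpotence

open MvPolynomial HahnSeries

variable {m : ℕ}

/-- A linear combination is finite, so pointwise nilpotence on generators gives one exponent for it.
Asking for all larger exponents makes sums immediate. -/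
lemma exists_pow_eq_zero_of_mem_span (f : Module.End ℂ (LaurentSeries (Fock m)))
    (S : Set (QField (Fock m))) (hS : ∀ A ∈ S, ∃ n, (f ^ n) (ser A) = 0) {A : QField (Fock m)}
    (hA : A ∈ Submodule.span ℂ S) : ∃ N, ∀ n ≥ N, (f ^ n) (ser A) = 0 := by
  have hle : ∀ (u : LaurentSeries (Fock m)) (N : ℕ), (f ^ N) u = 0 → ∀ n ≥ N, (f ^ n) u = 0 := by
    intro u N hN n hn
    obtain ⟨d, rfl⟩ := Nat.exists_eq_add_of_le' hn
    rw [_root_.pow_add, Module.End.mul_apply, hN, map_zero]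
  induction hA using Submodule.span_induction with
  | mem B hB =>
    obtain ⟨n, hn⟩ := hS B hB
    exact ⟨n, hle _ n hn⟩
  | zero => exact ⟨0, fun n _ => by rw [map_zero, map_zero]⟩
  | add A B _ _ hA hB =>
    obtain ⟨N, hN⟩ := hA
    obtain ⟨M, hM⟩ := hB
    exact ⟨max N M, fun n hn => by
      rw [map_add, map_add, hN n (le_of_max_le_left hn), hM n (le_of_max_le_right hn), add_zero]⟩
  | smul c A _ hA =>
    obtain ⟨N, hN⟩ := hA
    exact ⟨N, fun n hn => by rw [map_smul, map_smul, hN n hn, smul_zero]⟩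

variable [NeZero m]

/-- The derivative by the first creation operator of `b^(0)`. -/
def heisDeriv (m : ℕ) [NeZero m] : Module.End ℂ (LaurentSeries (Fock m)) :=
  (fockDeriv (.heis 0 0)).toLinearMap

lemma heisDeriv_apply (u : LaurentSeries (Fock m)) : heisDeriv m u = fockDeriv (.heis 0 0) u := rfl

lemma heisDeriv_pow_single_mul (n : ℕ) (c : ℂ) (k : ℤ) (u : LaurentSeries (Fock m)) :
    (heisDeriv m ^ n) (c • single k 1 * u) = c • single k 1 * (heisDeriv m ^ n) u := by
  induction n with
  | zero => simp
  | succ n ih =>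
    rw [pow_succ', Module.End.mul_apply, Module.End.mul_apply, ih, heisDeriv_apply, heisDeriv_apply,
      smul_mul_assoc, Derivation.map_smul, fockDeriv_single_mul, smul_mul_assoc]

/-- A letter is at most linear in b^(0)_(-1), so it raises the order of nilpotence by at most one.
-/
lemma heisDeriv_pow_creSer_mul (ε : ℂ) (b : Gen m × ℕ) (n : ℕ) (u : LaurentSeries (Fock m))
    (h : (heisDeriv m ^ n) u = 0) : (heisDeriv m ^ (n + 1)) (creSer ε b * u) = 0 := by
  induction n generalizing u with
  | zero =>
    have : u = 0 := by simpa using h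
    simp [this]
  | succ n ih =>
    obtain ⟨c, k, hck⟩ := exists_fockDeriv_creSer ε b (.heis 0 0)
    rw [pow_succ, Module.End.mul_apply, heisDeriv_apply, Derivation.leibniz, hck, map_add,
      smul_eq_mul, smul_eq_mul, ih, mul_comm u, heisDeriv_pow_single_mul, h, mul_zero, add_zero]
    rwa [pow_succ, Module.End.mul_apply, heisDeriv_apply] at h

lemma heisDeriv_pow_creProd (ε : ℂ) (L : List (Gen m × ℕ)) :
    (heisDeriv m ^ (L.length + 1)) (creProd ε L) = 0 := by
  induction L with
  | nil => simp [heisDeriv_apply]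
  | cons b L ih =>
    rw [creProd_cons]
    exact heisDeriv_pow_creSer_mul ε b _ _ ih

/-- The derivative twisted so as to kill `exp (t b^(0)_(-1) w)`. -/
def twistedDeriv (m : ℕ) [NeZero m] (t : ℂ) : Module.End ℂ (LaurentSeries (Fock m)) :=
  heisDeriv m - LinearMap.mulLeft ℂ (t • single 1 1)

lemma twistedDeriv_apply (t : ℂ) (u : LaurentSeries (Fock m)) :
    twistedDeriv m t u = heisDeriv m u - t • single 1 1 * u := rfl

/-- Conjugation by the exponential turns the twisted derivative into the plain one, so nilpotence on
polynomials carries over to polynomials times the exponential. -/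
lemma twistedDeriv_pow_mul_expCreSer (κ b : ℂ) (u : LaurentSeries (Fock m)) (n : ℕ) :
    (twistedDeriv m (b * κ) ^ n) (u * expCreSer κ b) = (heisDeriv m ^ n) u * expCreSer κ b := by
  induction n generalizing u with
  | zero => simp
  | succ n ih =>
    rw [pow_succ, Module.End.mul_apply, pow_succ, Module.End.mul_apply, ← ih]
    congr 1
    rw [twistedDeriv_apply, heisDeriv_apply, heisDeriv_apply, Derivation.leibniz,
      fockDeriv_heis_expCreSer]
    simp only [smul_eq_mul, smul_mul_assoc, mul_smul_comm]
    rw [mul_left_comm, mul_comm (expCreSer κ b)]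
    abel

/-- Differentiation commutes with multiplication by tw. In the binomial expansion of the twisted
power only the term without derivatives survives `ζ`, and (-tw)^T is invertible if t ≠ 0. -/
lemma coeffMap_twistedDeriv (t : ℂ) (ζ : Fock m →ₗ[ℂ] ℂ) (u : LaurentSeries (Fock m))
    (h : ∀ i, 0 < i → coeffMap ζ ((heisDeriv m ^ i) u) = 0) (T : ℕ) :
    coeffMap ζ ((twistedDeriv m t ^ T) u) = (-(t • single 1 1)) ^ T * coeffMap ζ u := by
  suffices H : ∀ i, coeffMap ζ ((heisDeriv m ^ i) ((twistedDeriv m t ^ T) u)) =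
      if i = 0 then (-(t • single 1 1)) ^ T * coeffMap ζ u else 0 by simpa using H 0
  induction T with
  | zero =>
    intro i
    split_ifs with hi
    · simp [hi]
    · simpa using h i (Nat.pos_of_ne_zero hi)
  | succ T ih =>
    intro i
    rw [pow_succ' (twistedDeriv m t), Module.End.mul_apply, twistedDeriv_apply, map_sub,
      ← Module.End.mul_apply, ← pow_succ, heisDeriv_pow_single_mul, map_sub,
      coeffMap_smul_single_mul, ih, ih, if_neg (Nat.succ_ne_zero i)]
    split_ifs
    · rw [pow_succ']
      ring
    · simp

end Nilpotence

/-! ### The grading by β^(0) and γ^(0). -/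

section Weight

open MvPolynomial HahnSeries

variable {m : ℕ} [NeZero m]

/-- The number of `β^(0)` minus the number of `γ^(0)`. -/
def oscWeight : Osc m → ℤ
  | .beta l _ => if l = 0 then 1 else 0
  | .gamma l _ => if l = 0 then -1 else 0
  | .heis _ _ => 0

/-- The weight of a generating field. -/
def genWeight (g : Gen m) : ℤ := oscWeight (oscOf g 0)

lemma oscWeight_oscOf (g : Gen m) (n : ℕ) : oscWeight (oscOf g n) = genWeight g := by
  cases g <;> rfl

/-- All coefficients of `u` are homogeneous of weight `q`. -/
def HasWeight (u : LaurentSeries (Fock m)) (q : ℤ) : Prop :=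
  ∀ n, IsWeightedHomogeneous oscWeight (u.coeff n) q

lemma HasWeight.mul {u v : LaurentSeries (Fock m)} {p q : ℤ} (hu : HasWeight u p)
    (hv : HasWeight v q) : HasWeight (u * v) (p + q) := by
  intro n
  rw [HahnSeries.coeff_mul]
  exact IsWeightedHomogeneous.sum _ _ _ fun x _ => (hu _).mul (hv _)

lemma HasWeight.fockDeriv {u : LaurentSeries (Fock m)} {q : ℤ} (hu : HasWeight u q) (x : Osc m) :
    HasWeight (fockDeriv x u) (q - oscWeight x) := fun n => (hu n).pderiv (by ring)

lemma HasWeight.heisDeriv_pow {u : LaurentSeries (Fock m)} {q : ℤ} (hu : HasWeight u q) (n : ℕ) :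
    HasWeight ((heisDeriv m ^ n) u) q := by
  induction n with
  | zero => exact hu
  | succ n ih =>
    rw [pow_succ', Module.End.mul_apply, heisDeriv_apply]
    simpa [oscWeight] using ih.fockDeriv (.heis 0 0)

lemma hasWeight_creProd (ε : ℂ) (L : List (Gen m × ℕ)) :
    HasWeight (creProd ε L) (L.map fun b => genWeight b.1).sum := by
  induction L with
  | nil =>
    intro n
    rw [creProd_nil, HahnSeries.coeff_one]
    split_ifs
    · exact isWeightedHomogeneous_one _ _
    · exact isWeightedHomogeneous_zero _ _ _
  | cons b L ih =>
    rw [creProd_cons, List.map_cons, List.sum_cons]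
    refine HasWeight.mul (fun n => ?_) ih
    rw [coeff_creSer]
    split_ifs
    · refine (weightedHomogeneousSubmodule ℂ oscWeight _).smul_mem _ ?_
      rw [mem_weightedHomogeneousSubmodule, ← oscWeight_oscOf b.1 (n + b.2 - lowExp b.1).toNat]
      exact isWeightedHomogeneous_X _ _ _
    · exact isWeightedHomogeneous_zero _ _ _

/-- The vacuum itself has weight zero. -/
lemma HasWeight.vacCoeff_eq_zero {u : LaurentSeries (Fock m)} {q : ℤ} (hu : HasWeight u q)
    (hq : q ≠ 0) : coeffMap vacCoeff u = 0 := by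
  ext1
  funext n
  rw [coeff_coeffMap, vacCoeff_apply, HahnSeries.coeff_zero, constantCoeff_eq]
  by_contra h
  exact hq (by simpa using (hu n h).symm)

lemma charge_eq (ε : ℂ) (L : List (Gen m × ℕ)) :
    charge ε L = -2 * ε * ((L.map fun b => genWeight b.1).sum : ℤ) := by
  rw [charge]
  congr 1
  induction L with
  | nil => simp
  | cons b L ih =>
    rw [List.countP_cons, List.countP_cons, List.map_cons, List.sum_cons]
    rw [Int.cast_add, ← ih]
    push_cast
    obtain ⟨g, d⟩ := b
    cases g with
    | beta l => by_cases h : l = 0 <;> simp [genWeight, oscOf, oscWeight, h]; ring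
    | gamma l => by_cases h : l = 0 <;> simp [genWeight, oscOf, oscWeight, h]; ring
    | heis l => simp [genWeight, oscOf, oscWeight]

end Weight

/-! ### Products that would be Laurent series in z - w: parts (A), (B), (C). -/

section LaurentOPE

open MvPolynomial HahnSeries

variable {m : ℕ}

lemma exists_polynomial_eval_eq_sum_choose (N : ℕ) (c : ℕ → ℂ) :
    ∃ q : Polynomial ℂ, ∀ p : ℕ,
      q.eval (p : ℂ) = ∑ j ∈ Finset.range N, ((p.choose j : ℕ) : ℂ) * c j := by
  refine ⟨∑ j ∈ Finset.range N, Polynomial.C (c j / j.factorial) * descPochhammer ℂ j, fun p => ?_⟩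
  rw [Polynomial.eval_finsetSum]
  refine Finset.sum_congr rfl fun j _ => ?_
  have hj : (j.factorial : ℂ) ≠ 0 := by exact_mod_cast j.factorial_ne_zero
  rw [Polynomial.eval_mul, Polynomial.eval_C, descPochhammer_eval_eq_descFactorial,
    Nat.descFactorial_eq_factorial_mul_choose, Nat.cast_mul]
  field_simp

/-- Along the line of total degree d - 1, the coefficients of (z - w)^(-j-1) are binomials (p choose
j), polynomial in p. At p = 0 only j = 0 contributes, so the residue is recovered from the
polynomial, and hence from its large values. -/
lemma exists_polynomial_of_OPE {a b : QField (Fock m)} {N : ℕ} {C : ℕ → QField (Fock m)}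
    (h : OPE a b (polarPart N C)) (ζ : Fock m →ₗ[ℂ] ℂ) (d : ℤ) :
    ∃ q : Polynomial ℂ, (0 < N → q.eval 0 = ζ ((C 0).1 d 1)) ∧
      ∃ p₀ : ℕ, ∀ p : ℕ, p₀ ≤ p → ζ (a.1 (-p - 1) (b.1 (p + d) 1)) = q.eval (p : ℂ) := by
  obtain ⟨q, hq⟩ := exists_polynomial_eval_eq_sum_choose N fun j => ζ ((C j).1 (d + j) 1)
  obtain ⟨K, hK⟩ := h 1
  refine ⟨q, fun hN => ?_, (-K).toNat, fun p hp => ?_⟩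
  · rw [← Nat.cast_zero, hq, Finset.sum_eq_single 0]
    · simp
    · intro j _ hj
      rw [Nat.choose_eq_zero_of_lt (Nat.pos_of_ne_zero hj), Nat.cast_zero, zero_mul]
    · intro h0
      exact absurd (Finset.mem_range.mpr hN) h0
  · have h1 := hK (-p - 1) (p + d) (Or.inl (by omega))
    rw [sub_eq_zero.mp h1, polarPart, if_pos (by omega), hq, LinearMap.sum_apply, map_sum]
    refine Finset.sum_congr rfl fun j _ => ?_
    rw [LinearMap.smul_apply, map_smul, smul_eq_mul, show (-(-(p : ℤ) - 1) - 1).toNat = p by omega,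
      show (p : ℤ) + d + (-p - 1) + 1 + j = d + j by ring]

/-- The functional `v ↦ ` constant coefficient of `∂_x ∂_y v`. -/
def vacDeriv (x y : Osc m) : Fock m →ₗ[ℂ] ℂ :=
  vacCoeff ∘ₗ (pderiv x).toLinearMap ∘ₗ (pderiv y).toLinearMap

lemma vacDeriv_apply (x y : Osc m) (v : Fock m) :
    vacDeriv x y v = vacCoeff (pderiv x (pderiv y v)) := rfl

lemma pderiv_apply_one (x : Osc m) (A : QField (Fock m)) (n : ℤ) :
    pderiv x (A.1 n 1) = (fockDeriv x (ser A)).coeff n := by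
  rw [coeff_coeffDeriv, coeff_ser]

lemma pderiv_pderiv_apply_one (x y : Osc m) (A : QField (Fock m)) (n : ℤ) :
    pderiv x (pderiv y (A.1 n 1)) = (fockDeriv x (fockDeriv y (ser A))).coeff n := by
  rw [coeff_coeffDeriv, coeff_coeffDeriv, coeff_ser]

lemma pderiv_oneField (x : Osc m) (n : ℤ) (v : Fock m) :
    pderiv x ((oneField (Fock m)).1 n v) = (oneField (Fock m)).1 n (pderiv x v) := by
  change pderiv x ((Pi.single 0 1 : ℤ → Module.End ℂ (Fock m)) n v) =
    (Pi.single 0 1 : ℤ → Module.End ℂ (Fock m)) n (pderiv x v)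
  by_cases h : n = 0
  · subst h; simp
  · simp [h]

variable [NeZero m]

lemma vacDeriv_gamma_beta_hOdd (ε s : ℂ) {l : Fin m} (hl : l ≠ 0) (n : ℤ) :
    vacDeriv (.gamma 0 0) (.beta l 0) ((hOdd ε s l).1 n 1) = if n = 0 then -1 else 0 := by
  rw [vacDeriv_apply, pderiv_pderiv_apply_one, fockDeriv_gamma_beta_hOdd ε s hl,
    HahnSeries.coeff_neg, HahnSeries.coeff_one]
  split_ifs <;> simp [vacCoeff_apply]

lemma pderiv_eEven (ε : ℂ) (x : Osc m) (hx : ∀ n, x ≠ .beta 0 n) (n : ℤ) (v : Fock m) :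
    pderiv x ((eEven m ε).1 n v) = (eEven m ε).1 n (pderiv x v) :=
  pderiv_nord_of_comm ε _ _ x (by simpa [oscOf] using hx) (pderiv_oneField x) n v

/-- The term -β^(l) γ^(0) of h^(l) is unreachable, as neither e^(0) nor f^(l) contains β^(l). The
interpolating polynomial has infinitely many roots, yet its value at 0 would be -1. -/
lemma not_hasResidue_eEven_fOdd (ε κ s : ℂ) {l : Fin m} (hl : l ≠ 0) :
    ¬ HasResidue (eEven m ε) (fOdd ε κ s l) (hOdd ε s l) := by
  rintro ⟨N, C, hN, hC, h⟩
  obtain ⟨q, hq0, p₀, hq⟩ := exists_polynomial_of_OPE h (vacDeriv (.gamma 0 0) (.beta l 0)) 0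
  have hroot : ∀ p : ℕ, p₀ ≤ p → q.IsRoot (p : ℂ) := by
    intro p hp
    rw [Polynomial.IsRoot, ← hq p hp, vacDeriv_apply, pderiv_eEven _ _ (by simp [hl]),
      pderiv_apply_one, fockDeriv_beta_fOdd ε κ s hl]
    simp
  have : q = 0 := by
    refine Polynomial.eq_zero_of_infinite_isRoot q
      (((Set.Ici_infinite p₀).image (f := fun p : ℕ => (p : ℂ)) fun x _ y _ h => by simpa using
        h).mono ?_)
    rintro _ ⟨p, hp, rfl⟩
    exact hroot p hp
  rw [this, hC, vacDeriv_gamma_beta_hOdd ε s hl] at hq0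
  simpa using hq0 hN

/-- The derivative by `β^(l)` on the raising operator `e^(l)`. -/
lemma pderiv_beta_eOdd (ε κ s : ℂ) (l : Fin m) (n : ℤ) (v : Fock m) :
    pderiv (.beta l 0) ((eOdd ε κ s l).1 n v) =
      (eOdd ε κ s l).1 n (pderiv (.beta l 0) v) + (vertexExp κ s⁻¹).1 (n + 1) v := by
  have := nprod_commutator (pderiv (.beta l 0)).toLinearMap (letterField ε (.beta l, 0))
    (vertexExp κ s⁻¹) 1 0 (-1) 0
    (fun i v => by
      have := pderiv_letterField_cre ε (.beta l, 0) (.beta l 0) i v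
      rw [fockDeriv_beta_creSer, if_pos rfl, HahnSeries.coeff_single] at this
      refine this.trans ?_
      congr 1
      split_ifs with h1 h2 h2
      · simp
      · exact absurd h1 (by simpa using h2)
      · exact absurd h2 (by simpa using h1)
      · simp)
    (fun i v => pderiv_letterField_ann ε _ _ i v)
    (fun n v => by simpa using pderiv_vertexExp_of_ne κ s⁻¹ (.beta l 0) (by simp) n v) n v
  simpa [eOdd, nord] using this

/-- If a power series `(1 - X)^(-θ)` has eventually polynomial coefficients, `θ` is an integer. -/
lemma exists_int_of_coeff_binomSeries (θ : ℂ) (c : ℂ) (hc : c ≠ 0) (q : Polynomial ℂ) (p₀ : ℕ)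
    (h : ∀ p : ℕ, p₀ ≤ p → c * PowerSeries.coeff p (binomSeries θ) = q.eval (p : ℂ)) :
    ∃ n : ℤ, θ = n := by
  refine exists_int_of_isPolarAt (ω := (1 : ℂ)) one_ne_zero (θ := θ)
    (g := binomSeriesAt (RingHom.id ℂ) 1 θ) (r := PowerSeries.C c)
    (binomSeriesAt_ode (RingHom.id ℂ) 1 θ) (.const c)
    ((IsPolarAt.mk_eval 1 q).congr p₀ fun j hj => ?_) ?_
  · rw [PowerSeries.coeff_C_mul, binomSeriesAt, PowerSeries.coeff_mk, PowerSeries.coeff_mk, ← h j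
      hj]
    simp
  · exact mul_ne_zero (by simpa using hc) (binomSeriesAt_ne_zero _ _ _)

lemma not_isLaurentOPE_eOdd_fOdd (ε κ s : ℂ) (hs : s ≠ 0)
    (hθ : ∀ n : ℤ, -(2 * s⁻¹ * (-s⁻¹) * κ ^ 2) ≠ (n : ℂ)) {l₁ l₂ : Fin m} (h₁ : l₁ ≠ 0)
    (h₂ : l₂ ≠ 0) : ¬ IsLaurentOPE (eOdd ε κ s l₁) (fOdd ε κ s l₂) := by
  rintro ⟨N, C, h⟩
  -- The derivative by β^(l₁) strips e^(l₁) to its exponential, and the other two strip f^(l₂). The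
  -- first lowers the power of z and the γ-derivative inserts a factor w; the choice d = 1 balances
  -- these shifts, leaving the coefficient of (w/z)^p.
  obtain ⟨q, -, p₀, hq⟩ := exists_polynomial_of_OPE h
    (vacCoeff ∘ₗ (pderiv (.gamma l₂ 0)).toLinearMap ∘ₗ (pderiv (.heis l₂ 0)).toLinearMap ∘ₗ
      (pderiv (.beta l₁ 0)).toLinearMap) 1
  suffices key : ∀ p : ℕ, p₀ ≤ p → s / 2 * PowerSeries.coeff p
      (binomSeries (-(2 * s⁻¹ * (-s⁻¹) * κ ^ 2))) = q.eval (p : ℂ) by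
    obtain ⟨n, hn⟩ := exists_int_of_coeff_binomSeries _ (s / 2) (by simpa using hs) q p₀ key
    exact hθ n hn
  intro p hp
  rw [← hq p hp]
  change _ = vacCoeff (pderiv _ (pderiv _ (pderiv _ _)))
  have h0 := congrArg (fun u => (PowerSeries.coeff p u).coeff (p : ℤ))
    (hat_expCreSer (m := m) ε κ s⁻¹ (-s⁻¹))
  simp only [coeff_hat, coeff_coeffMap, coeff_expCreSer, binomSeriesAt, PowerSeries.coeff_mk,
    lvar_pow,
    C_mul_eq_smul, HahnSeries.coeff_smul, HahnSeries.coeff_single_same, smul_eq_mul, mul_one] at h0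
  rw [pderiv_beta_eOdd, pderiv_apply_one, fockDeriv_beta_fOdd ε κ s h₁, HahnSeries.coeff_zero,
    LinearMap.map_zero, zero_add, pderiv_vertexExp_of_ne κ _ (.heis l₂ 0) (by simp [h₂]),
    pderiv_vertexExp_of_ne κ _ (.gamma l₂ 0) (by simp),
    pderiv_pderiv_apply_one, fockDeriv_gamma_heis_fOdd ε κ s h₂, HahnSeries.coeff_smul,
    coeff_single_mul, one_mul, coeff_expCreSer, map_smul, map_smul, smul_eq_mul, ← h0, modeFun,
    LinearMap.comp_apply]
  rw [show (-(p : ℤ) - 1 + 1) = -p by ring, show ((p : ℤ) + 1 - 1) = p by ring]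
  rfl

end LaurentOPE

/-! ### The bracket evaluated on the vacuum. -/

section Bracket

open HahnSeries

lemma sl2e_lie_sl2f : ⁅sl2e, sl2f⁆ = sl2h := by
  apply Subtype.ext
  change sl2e.1 * sl2f.1 - sl2f.1 * sl2e.1 = sl2h.1
  simp [sl2e, sl2f, sl2h]

variable (m r : ℕ) (c : ℂ)

lemma tu_mul_tu (i j : ℤ) (l l' : ℕ) :
    tu m r c i l * tu m r c j l' = tu m r c (i + j) (l + l') := by
  simp only [tu, LaurentPolynomial.T_add, map_mul, _root_.pow_add]
  ring

/-- The relation u^m = p(t), used when the sum of two sectors exceeds m - 1. -/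
lemma tu_add (i : ℤ) (l : ℕ) : tu m r c i (l + m) =
    tu m r c i l - (2 * c) • tu m r c (i + r) l + tu m r c (i + 2 * r) l := by
  have hroot : (AdjoinRoot.root ((Polynomial.X : Polynomial (LaurentPolynomial ℂ)) ^ m -
      Polynomial.C (pPoly r c))) ^ m = AdjoinRoot.of _ (pPoly r c) := by
    have := AdjoinRoot.eval₂_root ((Polynomial.X : Polynomial (LaurentPolynomial ℂ)) ^ m -
      Polynomial.C (pPoly r c))
    simpa [sub_eq_zero] using this
  let τ : LaurentPolynomial ℂ →ₐ[ℂ] superRing m r c := IsScalarTower.toAlgHom ℂ _ _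
  have hp : AdjoinRoot.of ((Polynomial.X : Polynomial (LaurentPolynomial ℂ)) ^ m -
      Polynomial.C (pPoly r c)) (pPoly r c) = 1 - (2 * c) • AdjoinRoot.of _ (LaurentPolynomial.T r)
        +
        AdjoinRoot.of _ (LaurentPolynomial.T (2 * r)) :=
    show τ (1 - (2 * c) • LaurentPolynomial.T (r : ℤ) + LaurentPolynomial.T (2 * r : ℤ)) =
      1 - (2 * c) • τ (LaurentPolynomial.T r) + τ (LaurentPolynomial.T (2 * r)) by
    rw [map_add, map_sub, map_one, map_smul]
  simp only [tu, _root_.pow_add, hroot, hp, LaurentPolynomial.T_add, map_mul]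
  rw [← smul_mul_assoc, ← mul_smul_comm]
  ring

variable {m r c}

lemma uceBracket_current (i j : ℤ) (l l' : ℕ) :
    uceBracket (current m r c sl2e i l) (current m r c sl2f j l') =
      current m r c sl2h (i + j) (l + l') +
        (0, cocycle m r c (current m r c sl2e i l).1 (current m r c sl2f j l').1) := by
  rw [uceBracket, current, current, current]
  simp only [LieAlgebra.ExtendScalars.bracket_tmul, sl2e_lie_sl2f, tu_mul_tu]
  simp

lemma current_add (x : sl2) (i : ℤ) (l : ℕ) : current m r c x i (l + m) =
    current m r c x i l - (2 * c) • current m r c x (i + r) l + current m r c x (i + 2 * r) l := by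
  simp only [current, tu_add, TensorProduct.add_tmul, TensorProduct.sub_tmul,
    ← TensorProduct.smul_tmul']
  ext <;> simp

variable [NeZero m]

/-- All that the obstructions use of a realization: far enough out in z, E_p F_q on the vacuum is a
coefficient of h^(l'), multiplied by p(w) if the sectors wrap around, up to a scalar. Derivatives
kill the scalar, so the cocycle never needs to be computed. -/
lemma RealizesBracket.exists_apply {ε s : ℂ} {l₁ l₂ : Fin m} {E F : QField (Fock m)}
    (h : RealizesBracket r c ε s l₁ l₂ E F) (l' : Fin m) (H : LaurentSeries (Fock m))
    (hl : ((l₁ : ℕ) + l₂ = l' ∧ H = ser (hField ε s l')) ∨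
      ((l₁ : ℕ) + l₂ = l' + m ∧ H = (1 - (2 * c) • single (r : ℤ) 1 + single (2 * r : ℤ) 1) *
        ser (hField ε s l'))) :
    ∃ K ≤ (0 : ℤ), ∀ p < K, ∀ q, ∃ χ : ℂ, E.1 p (F.1 q 1) = H.coeff (p + q + 1) + χ • 1 := by
  obtain ⟨ρ, -, -, hh, hχ, hope⟩ := h
  obtain ⟨K, hK⟩ := hope 1
  refine ⟨min K 0, min_le_right _ _, fun p hp q => ?_⟩
  have h1 := sub_eq_zero.mp (hK p q (Or.inl (lt_of_lt_of_le hp (min_le_left _ _))))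
  beta_reduce at h1
  obtain ⟨χ, hχ⟩ := hχ (cocycle m r c (current m r c sl2e (-p - 1) l₁).1
    (current m r c sl2f (-q - 1) l₂).1)
  refine ⟨χ, ?_⟩
  rw [if_pos (lt_of_lt_of_le hp (min_le_right _ _)), uceBracket_current,
    LinearMap.map_add, hχ] at h1
  rw [h1, LinearMap.add_apply, LinearMap.smul_apply]
  congr 1
  have hm : ∀ n : ℤ, ρ (current m r c sl2h n l') 1 = (ser (hField ε s l')).coeff (-n - 1) := by
    intro n
    rw [hh, coeff_ser]
    rfl
  rcases hl with ⟨hl, rfl⟩ | ⟨hl, rfl⟩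
  · rw [hl, hm]
    congr 1
    ring
  · rw [hl, current_add, map_add, map_sub, map_smul, LinearMap.add_apply, LinearMap.sub_apply,
      LinearMap.smul_apply, hm, hm, hm, add_mul, sub_mul, one_mul, smul_mul_assoc,
      HahnSeries.coeff_add, HahnSeries.coeff_sub, HahnSeries.coeff_smul, coeff_single_mul,
      coeff_single_mul, one_mul, one_mul]
    ring_nf

end Bracket

/-! ### Missing monomials: (D2), and (D3) away from l₁ + l₂ = m. -/

section Obstruction

open MvPolynomial HahnSeries

variable {m : ℕ}

/-- `p(t)`, as a Laurent series with coefficients in the Fock space. -/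
def curveSeries (m r : ℕ) (c : ℂ) : LaurentSeries (Fock m) :=
  1 - (2 * c) • single (r : ℤ) 1 + single (2 * r : ℤ) 1

lemma fockDeriv_curveSeries_mul (r : ℕ) (c : ℂ) (x : Osc m) (u : LaurentSeries (Fock m)) :
    fockDeriv x (curveSeries m r c * u) = curveSeries m r c * fockDeriv x u := by
  rw [Derivation.leibniz, curveSeries, map_add, map_sub, Derivation.map_smul, fockDeriv_one,
    coeffDeriv_single_one, coeffDeriv_single_one, smul_zero, sub_zero, add_zero, smul_zero,
    add_zero, smul_eq_mul]

lemma coeff_zero_curveSeries {r : ℕ} (hr : r ≠ 0) (c : ℂ) : (curveSeries m r c).coeff 0 = 1 := by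
  have : (0 : ℤ) ≠ r := by exact_mod_cast hr.symm
  rw [curveSeries, HahnSeries.coeff_add, HahnSeries.coeff_sub, HahnSeries.coeff_smul,
    HahnSeries.coeff_one, if_pos rfl, coeff_single_of_ne this, coeff_single_of_ne (by omega)]
  simp

variable [NeZero m]

lemma pderiv_raising (ε κ a : ℂ) {l : Fin m} {L : List (Gen m × ℕ)}
    (hL : ∀ b ∈ L, b.1 = .beta l ∨ b.1 = .gamma l) (x : Osc m)
    (hx : ∀ n, x ≠ .beta l n ∧ x ≠ .gamma l n ∧ x ≠ .heis 0 n) (n : ℤ) (v : Fock m) :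
    pderiv x ((nord ε L (vertexExp κ a)).1 n v) = (nord ε L (vertexExp κ a)).1 n (pderiv x v) := by
  refine pderiv_nord_of_comm ε L _ x (fun b hb n => ?_)
    (pderiv_vertexExp_of_ne κ a x fun n => (hx n).2.2) n v
  rcases hL b hb with h | h <;> rw [h]
  exacts [(hx n).1, (hx n).2.1]

lemma pderiv_heis_raising (ε κ a : ℂ) {l : Fin m} {L : List (Gen m × ℕ)}
    (hL : ∀ b ∈ L, b.1 = .beta l ∨ b.1 = .gamma l) (n : ℤ) (v : Fock m) :
    pderiv (.heis 0 0) ((nord ε L (vertexExp κ a)).1 n v) =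
      (nord ε L (vertexExp κ a)).1 n (pderiv (.heis 0 0) v) +
        (a * κ) • (nord ε L (vertexExp κ a)).1 (n - 1) v := by
  refine pderiv_nord ε L _ _ (fun b hb n => ?_) _
    (pderiv_vertexExp κ a _ _ (pderiv_heis_expCre κ a)) n v
  rcases hL b hb with h | h <;> rw [h] <;> simp [oscOf]

lemma not_realizesBracket_fEven {r : ℕ} {c ε κ s : ℂ} (hs : s ≠ 0) {l : Fin m} (hl : l ≠ 0)
    {E : QField (Fock m)} (hE : IsWakimotoRaising ε κ s⁻¹ l E) :
    ¬ RealizesBracket r c ε s l 0 E (fEven m ε s) := by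
  intro h
  obtain ⟨L, hL, rfl⟩ := hE
  obtain ⟨K, -, hK⟩ := h.exists_apply l _ (Or.inl ⟨by simp, rfl⟩)
  -- Here p + q + 1 = 0. The constant coefficient of h^(l) contains (√k/2) b^(l)_(-1), and b^(l)
  -- occurs neither in E nor in f^(0).
  obtain ⟨χ, hχ⟩ := hK (K - 1) (by omega) (-K)
  have h1 := congrArg (fun v => vacCoeff (pderiv (.heis l 0) v)) hχ
  beta_reduce at h1
  rw [pderiv_raising ε κ s⁻¹ hL _ (by simp [hl]), pderiv_apply_one, fockDeriv_heis_fEven ε s hl,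
    hField, if_neg hl, map_add, ← coeff_coeffDeriv, fockDeriv_heis_hOdd, HahnSeries.coeff_smul,
    show K - 1 + -K + 1 = 0 by ring, HahnSeries.coeff_one, if_pos rfl] at h1
  simp [vacCoeff_apply, smul_eq_C_mul] at h1
  exact div_ne_zero hs two_ne_zero h1.symm

lemma fockDeriv_lowering_eq_zero {ε κ a : ℂ} {l : Fin m} {P : List (Gen m × ℕ) → Prop}
    {F : QField (Fock m)} (hF : IsWakimotoLowering ε κ a l P F) {l' : Fin m} (h0 : l' ≠ 0)
    (hl : l' ≠ l) : fockDeriv (.beta l' 0) (ser F) = 0 := by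
  obtain ⟨Y, Z, hY, hZ, rfl⟩ := hF
  have hcre : ∀ L ∈ lowerMonomials l, fockDeriv (.beta l' 0) (creProd ε L) = 0 := by
    intro L hL
    refine fockDeriv_creProd_eq_zero ε L _ fun b hb n => ?_
    rcases hL b hb with h | h | h | h | ⟨j, h⟩ <;> rw [h] <;> simp [oscOf, h0, hl]
  let φ : QField (Fock m) →ₗ[ℂ] LaurentSeries (Fock m) :=
    (fockDeriv (.beta l' 0)).toLinearMap ∘ₗ ser
  have hY' : Y ∈ LinearMap.ker φ := by
    refine Submodule.span_le.mpr ?_ hY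
    rintro _ ⟨L, hL, rfl⟩
    change fockDeriv _ (ser (nord ε L _)) = 0
    rw [ser_nord, Derivation.leibniz, hcre L hL, ser_vertexExp,
      fockDeriv_expCreSer_of_ne κ _ _ (by simp), smul_zero, smul_zero, add_zero]
  have hZ' : Z ∈ LinearMap.ker φ := by
    refine Submodule.span_le.mpr ?_ hZ
    rintro _ ⟨L, hL, rfl⟩
    change fockDeriv _ (ser (nord ε L _)) = 0
    rw [ser_nord, ser_oneField, mul_one, hcre L hL.1]
  exact (LinearMap.ker φ).add_mem hY' hZ'

lemma not_realizesBracket_of_ne_zero {r : ℕ} (hr : r ≠ 0) {c ε κ s : ℂ} {l₁ l₂ : Fin m}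
    (h₁ : l₁ ≠ 0) (h₂ : l₂ ≠ 0) (h₁₂ : (l₁ : ℕ) + l₂ ≠ m) {P : List (Gen m × ℕ) → Prop}
    {E F : QField (Fock m)} (hE : IsWakimotoRaising ε κ s⁻¹ l₁ E)
    (hF : IsWakimotoLowering ε κ s⁻¹ l₂ P F) : ¬ RealizesBracket r c ε s l₁ l₂ E F := by
  intro h
  obtain ⟨L, hL, rfl⟩ := hE
  have hlt₁ := l₁.isLt
  have hlt₂ := l₂.isLt
  have hv₁ : (l₁ : ℕ) ≠ 0 := fun h => h₁ (Fin.ext (by simpa using h))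
  have hv₂ : (l₂ : ℕ) ≠ 0 := fun h => h₂ (Fin.ext (by simpa using h))
  -- The target sector is l₁ + l₂ modulo m; it differs from 0, l₁ and l₂, so β^(l') is absent from
  -- both fields. The factor `W` is 1 or p(w), with constant coefficient 1 in either case.
  obtain ⟨l', W, hl', hW, hcoeff, hder⟩ : ∃ (l' : Fin m) (W : LaurentSeries (Fock m)),
      ((l' : ℕ) ≠ 0 ∧ (l' : ℕ) ≠ l₁ ∧ (l' : ℕ) ≠ l₂) ∧
      (((l₁ : ℕ) + l₂ = l' ∧ W * ser (hField ε s l') = ser (hField ε s l')) ∨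
      ((l₁ : ℕ) + l₂ = l' + m ∧ W * ser (hField ε s l') =
        (1 - (2 * c) • single (r : ℤ) 1 + single (2 * r : ℤ) 1) * ser (hField ε s l'))) ∧
      W.coeff 0 = 1 ∧ ∀ x u, fockDeriv x (W * u) = W * fockDeriv x u := by
    rcases lt_or_ge ((l₁ : ℕ) + l₂) m with hlt | hge
    · refine ⟨⟨l₁ + l₂, hlt⟩, 1, ⟨?_, ?_, ?_⟩, Or.inl ⟨rfl, one_mul _⟩, ?_, ?_⟩
      · dsimp; omega
      · dsimp; omega
      · dsimp; omega
      · rw [HahnSeries.coeff_one, if_pos rfl]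
      · intro x u
        rw [one_mul, one_mul]
    · refine ⟨⟨l₁ + l₂ - m, by omega⟩, curveSeries m r c, ⟨?_, ?_, ?_⟩, Or.inr ⟨?_, rfl⟩,
        coeff_zero_curveSeries hr c, fockDeriv_curveSeries_mul r c⟩
      all_goals dsimp; omega
  have hl0 : l' ≠ 0 := fun h => hl'.1 (by rw [h]; rfl)
  have hl1 : l' ≠ l₁ := fun h => hl'.2.1 (by rw [h])
  have hl2 : l' ≠ l₂ := fun h => hl'.2.2 (by rw [h])
  obtain ⟨K, -, hK⟩ := h.exists_apply l' _ hW
  obtain ⟨χ, hχ⟩ := hK (K - 1) (by omega) (-K)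
  have hneg : (W * -1).coeff 0 = -1 := (congrArg (fun u => u.coeff 0) (mul_neg_one W)).trans
    (by rw [HahnSeries.coeff_neg, hcoeff])
  have h1 := congrArg (vacDeriv (.gamma 0 0) (.beta l' 0)) hχ
  rw [vacDeriv_apply, pderiv_raising ε κ s⁻¹ hL _ (by simp [hl1]), pderiv_apply_one,
    fockDeriv_lowering_eq_zero hF hl0 hl2, vacDeriv_apply, map_add, map_add, ← coeff_coeffDeriv,
    ← coeff_coeffDeriv, hder, hder, hField, if_neg hl0, fockDeriv_gamma_beta_hOdd ε s hl0,
    show K - 1 + -K + 1 = 0 by ring, hneg] at h1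
  simp [vacCoeff_apply] at h1

end Obstruction

/-! ### Branching: (D3) for l₁ + l₂ = m. -/

section Opposite

open MvPolynomial HahnSeries

variable {m : ℕ}

/-- The functional calculus with the derivative that shifts a raising operator. -/
lemma apply_raising_pow {x : Osc m} {τ : ℂ} {E : ℤ → Module.End ℂ (Fock m)} (ζ : Fock m →ₗ[ℂ] ℂ)
    (hE : ∀ n v, pderiv x (E n v) = E n (pderiv x v) + τ • E (n - 1) v) (v H : ℤ → Fock m) (K : ℤ)
    (hH : ∀ i p q, p < K → ζ (((pderiv x).toLinearMap ^ i) (E p (v q))) =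
      if i = 0 then ζ (H (p + q + 1)) else 0) (T : ℕ) (p q : ℤ) (hp : p < K) :
    ζ (E p (((pderiv x).toLinearMap ^ T) (v q))) = (-τ) ^ T * ζ (H (p - T + q + 1)) := by
  -- Moving one derivative across E produces a term with an outer derivative, so the induction must
  -- carry every `i`; these terms vanish under `ζ`. Lowering p preserves p < K.
  suffices h : ∀ i p, p < K → ζ (((pderiv x).toLinearMap ^ i) (E p (((pderiv x).toLinearMap ^ T) (v
    q)))) =
      if i = 0 then (-τ) ^ T * ζ (H (p - T + q + 1)) else 0 by simpa using h 0 p hp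
  induction T with
  | zero => intro i p hp; simpa using hH i p q hp
  | succ T ih =>
    intro i p hp
    have h1 : E p (((pderiv x).toLinearMap ^ (T + 1)) (v q)) =
        (pderiv x).toLinearMap (E p (((pderiv x).toLinearMap ^ T) (v q))) -
          τ • E (p - 1) (((pderiv x).toLinearMap ^ T) (v q)) := by
      rw [pow_succ', Module.End.mul_apply]
      exact eq_sub_of_add_eq (hE p _).symm
    rw [h1, map_sub, map_smul, map_sub, map_smul, ← Module.End.mul_apply, ← pow_succ, ih _ _ hp,
      ih _ _ (by omega), if_neg (Nat.succ_ne_zero i)]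
    split_ifs
    · rw [pow_succ', smul_eq_mul, show p - 1 - (T : ℤ) = p - ((T + 1 : ℕ) : ℤ) by push_cast; ring]
      ring
    · simp

lemma exists_coeff_curveSeries (r : ℕ) (c : ℂ) (n : ℤ) :
    ∃ t, (curveSeries m r c).coeff n = MvPolynomial.C t := by
  have h1 : ∀ k : ℤ, (single k 1 : LaurentSeries (Fock m)).coeff n =
      MvPolynomial.C (if n = k then 1 else 0) := by
    intro k
    rw [HahnSeries.coeff_single]
    split_ifs <;> simp
  refine ⟨(if n = 0 then 1 else 0) - 2 * c * (if n = r then 1 else 0) +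
    if n = 2 * r then 1 else 0, ?_⟩
  rw [curveSeries, ← single_zero_one, HahnSeries.coeff_add, HahnSeries.coeff_sub,
    HahnSeries.coeff_smul, h1, h1, h1, smul_eq_C_mul, MvPolynomial.C_add,
    MvPolynomial.C_sub, ← MvPolynomial.C_mul]

variable [NeZero m]

/-- The series spanned over `ℂ` by shifts of creation monomials times the exponential. -/
inductive IsLowerSeries (ε κ b : ℂ) : LaurentSeries (Fock m) → Prop
  | zero : IsLowerSeries ε κ b 0
  | add {u v} (hu : IsLowerSeries ε κ b u) (hv : IsLowerSeries ε κ b v) : IsLowerSeries ε κ b (u +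
    v)
  | monomial (t : ℂ) (k : ℤ) (L : List (Gen m × ℕ)) :
      IsLowerSeries ε κ b (t • single k 1 * (creProd ε L * expCreSer κ b))

namespace IsLowerSeries

variable {ε κ b : ℂ} {u : LaurentSeries (Fock m)}

lemma creSer_mul (hu : IsLowerSeries ε κ b u) (c : Gen m × ℕ) :
    IsLowerSeries ε κ b (creSer ε c * u) := by
  induction hu with
  | zero => rw [mul_zero]; exact .zero
  | add _ _ hu hv => rw [mul_add]; exact hu.add hv
  | monomial t k L =>
    rw [mul_left_comm, ← mul_assoc (creSer ε c), ← creProd_cons]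
    exact .monomial t k _

lemma smul_single_mul (hu : IsLowerSeries ε κ b u) (t : ℂ) (k : ℤ) :
    IsLowerSeries ε κ b (t • single k 1 * u) := by
  induction hu with
  | zero => rw [mul_zero]; exact .zero
  | add _ _ hu hv => rw [mul_add]; exact hu.add hv
  | monomial t' k' L =>
    rw [← mul_assoc, smul_mul_smul_comm, single_mul_single, one_mul]
    exact .monomial _ _ _

lemma fockDeriv (hu : IsLowerSeries ε κ b u) (x : Osc m) (t : ℂ)
    (hx : fockDeriv x (expCreSer κ b : LaurentSeries (Fock m)) = t • (single 1 1 * expCreSer κ b)) :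
    IsLowerSeries ε κ b (fockDeriv x u) := by
  induction hu with
  | zero => rw [map_zero]; exact .zero
  | add _ _ hu hv => rw [map_add]; exact hu.add hv
  | monomial t' k L =>
    rw [smul_mul_assoc, Derivation.map_smul, fockDeriv_single_mul, ← smul_mul_assoc]
    refine smul_single_mul ?_ t' k
    induction L with
    | nil =>
      rw [creProd_nil, one_mul, hx]
      simpa using IsLowerSeries.monomial (ε := ε) (κ := κ) (b := b) t 1 []
    | cons c L ih =>
      obtain ⟨t'', k', h⟩ := exists_fockDeriv_creSer ε c x
      rw [creProd_cons, mul_assoc (creSer ε c), Derivation.leibniz, h]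
      refine (creSer_mul ih c).add ?_
      rw [smul_eq_mul, mul_comm]
      exact .monomial t'' k' L

lemma smul (hu : IsLowerSeries ε κ b u) (t : ℂ) : IsLowerSeries ε κ b (t • u) := by
  simpa using hu.smul_single_mul t 0

lemma isBinomMultiple_hat (hu : IsLowerSeries ε κ b u) (a : ℂ) {l : Fin m}
    {L : List (Gen m × ℕ)} (hL : ∀ b ∈ L, b.1 = .beta l ∨ b.1 = .gamma l) :
    IsBinomMultiple (-(2 * a * b * κ ^ 2)) (hat (modeFun ε κ a L) u) := by
  induction hu with
  | zero => rw [map_zero]; exact .zero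
  | add _ _ hu hv => rw [map_add]; exact hu.add hv
  | monomial t k L' =>
    rw [hat_smul_single_mul]
    exact .polar_mul (.const _) (Superelliptic.isBinomMultiple_hat ε κ a b l L hL L')

end IsLowerSeries

lemma isLowerSeries_of_mem_span {ε κ b : ℂ} {S : Set (List (Gen m × ℕ))} {Y : QField (Fock m)}
    (hY : Y ∈ Submodule.span ℂ ((fun L => nord ε L (vertexExp κ b)) '' S)) :
    IsLowerSeries ε κ b (ser Y) := by
  induction hY using Submodule.span_induction with
  | mem A hA =>
    obtain ⟨L, -, rfl⟩ := hA
    dsimp only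
    rw [ser_nord, ser_vertexExp]
    simpa using IsLowerSeries.monomial (κ := κ) (b := b) (ε := ε) 1 0 L
  | zero => rw [map_zero]; exact .zero
  | add A B _ _ hA hB => rw [map_add]; exact hA.add hB
  | smul t A _ hA => rw [map_smul]; exact hA.smul t

lemma heisDeriv_pow_coeff (A : QField (Fock m)) (i : ℕ) (n : ℤ) :
    ((heisDeriv m ^ i) (ser A)).coeff n = ((pderiv (.heis 0 0)).toLinearMap ^ i) (A.1 n 1) := by
  induction i generalizing n with
  | zero => simp
  | succ i ih =>
    rw [pow_succ', pow_succ', Module.End.mul_apply, Module.End.mul_apply, ← ih]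
    rfl

/-- The target is p(w) h^(0), whose term -2 β^(0) γ^(0) may well occur in F, so no monomial is
missing. Differentiating by b^(0)_(-1) until Z disappears isolates the branched exponential part. -/
lemma not_realizesBracket_of_add_eq {r : ℕ} (hr : r ≠ 0) {c ε κ s : ℂ} (hs : s ≠ 0) (hκ : κ ≠ 0)
    (hθ : ∀ n : ℤ, -(2 * s⁻¹ * (-s⁻¹) * κ ^ 2) ≠ (n : ℂ)) {l₁ l₂ : Fin m}
    (h₁ : l₁ ≠ 0) (h₁₂ : (l₁ : ℕ) + l₂ = m) {P : List (Gen m × ℕ) → Prop}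
    {E F : QField (Fock m)} (hE : IsWakimotoRaising ε κ s⁻¹ l₁ E)
    (hF : IsWakimotoLowering ε κ s⁻¹ l₂ P F) : ¬ RealizesBracket r c ε s l₁ l₂ E F := by
  intro h
  obtain ⟨L, hL, rfl⟩ := hE
  obtain ⟨Y, Z, hY, hZ, rfl⟩ := hF
  obtain ⟨K, hK0, hK⟩ := h.exists_apply 0 (curveSeries m r c * ser (hField ε s 0))
    (Or.inr ⟨by simpa using h₁₂, rfl⟩)
  rw [hField, if_pos rfl] at hK
  set G := nord ε L (vertexExp κ s⁻¹) with hG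
  set H := curveSeries m r c * ser (hEven m ε s) with hH
  let ζ : Fock m →ₗ[ℂ] ℂ := vacDeriv (.gamma 0 0) (.beta 0 0)
  let D : Module.End ℂ (Fock m) := (pderiv (.heis 0 0)).toLinearMap
  let w : LaurentSeries ℂ := coeffMap vacCoeff (curveSeries m r c)
  have hw : w ≠ 0 := fun h => by
    have := congrArg (fun u => u.coeff 0) h
    dsimp only [w] at this
    rw [coeff_coeffMap, coeff_zero_curveSeries hr, vacCoeff_apply, map_one] at this
    exact one_ne_zero this
  obtain ⟨T, hT⟩ := exists_pow_eq_zero_of_mem_span (heisDeriv m) _ (by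
    rintro _ ⟨L, -, rfl⟩
    refine ⟨L.length + 1, ?_⟩
    dsimp only
    rw [ser_nord, ser_oneField, mul_one, heisDeriv_pow_creProd]) hZ
  have hHζ : ∀ n, ζ (H.coeff n) = -2 * w.coeff n := by
    intro n
    change vacCoeff ((fockDeriv (.gamma 0 0) (fockDeriv (.beta 0 0) H)).coeff n) = _
    rw [hH, fockDeriv_curveSeries_mul, fockDeriv_curveSeries_mul, fockDeriv_gamma_beta_hEven,
      mul_smul_comm, mul_one, HahnSeries.coeff_smul, map_smul, smul_eq_mul]
    rfl
  have hζC : ∀ (i : ℕ) (t : ℂ), ζ ((D ^ i) (MvPolynomial.C t)) = 0 := by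
    intro i t
    rcases i with _ | i
    · simp [ζ, vacDeriv_apply]
    · rw [pow_succ, Module.End.mul_apply, show D (MvPolynomial.C t) = 0 from pderiv_C, map_zero,
        map_zero]
  -- In p(w) h^(0) the variable b^(0)_(-1) occurs only linearly, with scalar coefficient. Hence `ζ`,
  -- which differentiates by β^(0) and γ^(0), kills every positive power of `D` on it, as
  -- `apply_raising_pow` requires.
  have hHD : ∀ n, ∃ t, D (H.coeff n) = MvPolynomial.C t := by
    intro n
    have hHx : fockDeriv (.heis 0 0) H = s • curveSeries m r c := by
      rw [hH, fockDeriv_curveSeries_mul, ser_hEven]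
      simp [fockDeriv_heis_creSer, Derivation.leibniz]
    obtain ⟨t, ht⟩ := exists_coeff_curveSeries (m := m) r c n
    refine ⟨s * t, ?_⟩
    change (fockDeriv (.heis 0 0) H).coeff n = _
    rw [hHx, HahnSeries.coeff_smul, ht, smul_eq_C_mul, MvPolynomial.C_mul]
  have key := apply_raising_pow ζ (pderiv_heis_raising ε κ s⁻¹ hL) (fun q => (Y + Z).1 q 1) H.coeff
    K
    (fun i p q hp => by
      obtain ⟨χ, hχ⟩ := hK p hp q
      rw [hχ]
      rcases i with _ | i
      · have h1 := hζC 0 χ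
        rw [if_pos rfl, pow_zero, Module.End.one_apply, map_add, smul_eq_C_mul, mul_one]
        rw [pow_zero, Module.End.one_apply] at h1
        rw [h1, add_zero]
      · obtain ⟨t, ht⟩ := hHD (p + q + 1)
        rw [if_neg (Nat.succ_ne_zero i), pow_succ, Module.End.mul_apply, map_add,
          show (pderiv (.heis 0 0)).toLinearMap (H.coeff (p + q + 1)) = MvPolynomial.C t from ht]
        rw [show (pderiv (.heis 0 0 : Osc m)).toLinearMap (χ • 1 : Fock m) = 0 by simp, add_zero]
        exact hζC i t) T
  set u := fockDeriv (.gamma 0 0) (fockDeriv (.beta 0 0) ((heisDeriv m ^ T) (ser Y))) with hu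
  have hser : (heisDeriv m ^ T) (ser (Y + Z)) = (heisDeriv m ^ T) (ser Y) := by
    rw [map_add, map_add, hT T le_rfl, add_zero]
  have hlow : IsLowerSeries ε κ (-s⁻¹) u := by
    refine IsLowerSeries.fockDeriv (IsLowerSeries.fockDeriv ?_ _ 0 ?_) _ 0 ?_
    · suffices h : ∀ i, IsLowerSeries ε κ (-s⁻¹) ((heisDeriv m ^ i) (ser Y)) from h T
      intro i
      induction i with
      | zero => exact isLowerSeries_of_mem_span hY
      | succ i ih =>
        rw [pow_succ', Module.End.mul_apply]
        exact ih.fockDeriv _ _ (fockDeriv_heis_expCreSer κ _)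
    · rw [zero_smul, fockDeriv_expCreSer_of_ne κ _ _ (by simp)]
    · rw [zero_smul, fockDeriv_expCreSer_of_ne κ _ _ (by simp)]
  -- The predicted coefficient of z^(-j) is W(w) w^j for all large j: -2 comes from h^(0), (-ακ)^T
  -- and the shift by T from crossing E, and the further shift by -1 from the index p + q + 1.
  let W : LaurentSeries ℂ := ((-(s⁻¹ * κ)) ^ T * -2) • (single (T - 1 : ℤ) 1 * w)
  have hcoeff : ∀ j : ℕ, (-K).toNat + 1 ≤ j →
      PowerSeries.coeff j (hat (modeFun ε κ s⁻¹ L) u) = W * lvar ^ j := by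
    intro j hj
    ext1
    funext q
    have h1 := key (-j) q (by omega)
    rw [hHζ] at h1
    rw [← heisDeriv_pow_coeff, hser] at h1
    change vacCoeff (pderiv _ (pderiv _ _)) = _ at h1
    rw [pderiv_raising ε κ s⁻¹ hL _ (by simp [h₁.symm]),
      pderiv_raising ε κ s⁻¹ hL _ (by simp [h₁.symm]), ← coeff_coeffDeriv, ← coeff_coeffDeriv] at h1
    rw [coeff_hat, coeff_coeffMap, modeFun, LinearMap.comp_apply, h1, lvar_pow, mul_comm W,
      coeff_single_mul, one_mul, HahnSeries.coeff_smul, coeff_single_mul, one_mul, smul_eq_mul,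
        mul_assoc,
      show -(j : ℤ) - T + q + 1 = q - j - (T - 1) by ring]
  have hW : W ≠ 0 := by
    refine smul_ne_zero (mul_ne_zero (pow_ne_zero _ (neg_ne_zero.mpr (mul_ne_zero (inv_ne_zero hs)
      hκ)))
      (by norm_num)) (mul_ne_zero ?_ hw)
    exact single_ne_zero one_ne_zero
  obtain ⟨ρ, hρ, hρu⟩ := hlow.isBinomMultiple_hat s⁻¹ hL
  have hpolar : IsPolarAt lvar (hat (modeFun ε κ s⁻¹ L) u) :=
    ((IsPolarAt.const W).mul (.mk_eval lvar 1)).congr _ fun j hj => by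
      rw [hcoeff j hj, PowerSeries.coeff_C_mul, PowerSeries.coeff_mk]
      simp
  have hne : hat (modeFun ε κ s⁻¹ L) u ≠ 0 := fun h => by
    have h1 := hcoeff _ le_rfl
    rw [h, map_zero] at h1
    exact mul_ne_zero hW (pow_ne_zero _ (single_ne_zero one_ne_zero)) h1.symm
  have : CharZero (LaurentSeries ℂ) :=
    charZero_of_injective_ringHom (HahnSeries.C_injective (Γ := ℤ) (R := ℂ))
  obtain ⟨n, hn⟩ := exists_int_of_isPolarAt (single_ne_zero one_ne_zero)
    (binomSeriesAt_ode HahnSeries.C lvar _) hρ (hρu ▸ hpolar) (hρu ▸ hne)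
  exact hθ n (HahnSeries.C_injective (hn.trans (map_intCast HahnSeries.C n).symm))

end Opposite

/-! ### The charge argument: (D1). -/

section Charge

open MvPolynomial HahnSeries

variable {m : ℕ} [NeZero m]

/-- At z^n with n ≤ -2 the mode of β^(0) is an annihilation operator, namely -ε times a derivative
by γ^(0). -/
lemma vacCoeff_eEven (ε : ℂ) (n : ℤ) (hn : n ≤ -2) (v : Fock m) :
    vacCoeff ((eEven m ε).1 n v) = -ε * vacCoeff (pderiv (.gamma 0 (-n - 2).toNat) v) := by
  have h1 : (letterField ε (.beta 0, 0) : FreeField (Fock m)).ann n =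
      (-ε) • annih (.gamma 0 (-n - 2).toNat) := by
    change (genField ε (.beta 0)).ann n = _
    refine (if_pos ?_).trans ?_
    · simp only [IsAnn, modeIndex]; omega
    · refine (if_neg ?_).trans ?_
      · simp only [modeIndex]; omega
      · simp only [modeIndex]
        congr 3
        omega
  rw [eEven, nord_cons, vacCoeff_nprod, finsum_eq_single _ n, h1]
  · change vacCoeff ((Pi.single 0 1 : ℤ → Module.End ℂ (Fock m)) (n - n) _) = _
    rw [sub_self, Pi.single_eq_same, Module.End.one_apply, LinearMap.smul_apply, map_smul,
      smul_eq_mul]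
    rfl
  · intro i hi
    change vacCoeff ((Pi.single 0 1 : ℤ → Module.End ℂ (Fock m)) (n - i) _) = _
    rw [Pi.single_eq_of_ne (sub_ne_zero.mpr hi.symm), LinearMap.zero_apply, map_zero]

/-- As ε = ±1, charge 0 or -2 means weight 0 or ε, whereas two γ^(0)-derivatives reach the vacuum
only from weight -2. -/
lemma weight_ne_of_charge {ε : ℂ} (hε : ε = 1 ∨ ε = -1) {L : List (Gen m × ℕ)}
    (hL : charge ε L = 0 ∨ charge ε L = -2) : (L.map fun b => genWeight b.1).sum + 2 ≠ 0 := by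
  intro h
  rw [charge_eq, eq_neg_of_add_eq_zero_left h] at hL
  rcases hε with rfl | rfl <;> norm_num at hL

lemma not_realizesBracket_eEven {r : ℕ} {c ε κ s : ℂ} (hs : s ≠ 0) (hκ : κ ≠ 0)
    (hε : ε = 1 ∨ ε = -1) {l : Fin m} (hl : l ≠ 0) {F : QField (Fock m)}
    (hF : IsWakimotoLowering ε κ s⁻¹ l (fun L => charge ε L = 0 ∨ charge ε L = -2) F) :
    ¬ RealizesBracket r c ε s 0 l (eEven m ε) F := by
  intro h
  have hε0 : ε ≠ 0 := by rcases hε with rfl | rfl <;> norm_num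
  obtain ⟨Y, Z, hY, hZ, rfl⟩ := hF
  obtain ⟨K, hK0, hK⟩ := h.exists_apply l _ (Or.inl ⟨by simp, rfl⟩)
  rw [hField, if_neg hl] at hK
  -- Since K ≤ 0, this p lies both in the range where the bracket formula holds and in that where
  -- β^(0) annihilates.
  set p := K - 2 with hp
  let δ : Fock m →ₗ[ℂ] Fock m := (pderiv (.gamma 0 0)).toLinearMap ∘ₗ (pderiv (.beta l
    0)).toLinearMap
  let ζ : Fock m →ₗ[ℂ] ℂ := vacCoeff ∘ₗ (pderiv (.gamma 0 (-p - 2).toNat)).toLinearMap ∘ₗ δ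
  let D : Module.End ℂ (Fock m) := (pderiv (.heis 0 0)).toLinearMap
  let t : ℂ := -s⁻¹ * κ
  have hE : ∀ (i : ℕ) v, vacCoeff (δ ((D ^ i) ((eEven m ε).1 p v))) = -ε * ζ ((D ^ i) v) := by
    intro i v
    have hD : (D ^ i) ((eEven m ε).1 p v) = (eEven m ε).1 p ((D ^ i) v) := by
      induction i with
      | zero => rfl
      | succ i ih =>
        rw [pow_succ', Module.End.mul_apply, Module.End.mul_apply, ih]
        exact pderiv_eEven ε _ (by simp) p _
    rw [hD]
    change vacCoeff (pderiv _ (pderiv _ _)) = _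
    rw [pderiv_eEven ε _ (by simp [hl]), pderiv_eEven ε _ (by simp), vacCoeff_eEven ε p (by omega)]
    rfl
  -- Under `ζ` the series F must look like a single nonzero monomial without any b^(0)_(-1), because
  -- h^(l) with l ≠ 0 does not involve b^(0).
  have hζ : ∀ (i : ℕ) q, -ε * (coeffMap ζ ((heisDeriv m ^ i) (ser (Y + Z)))).coeff q =
      if i = 0 then (if p + q + 1 = 0 then -1 else 0) else 0 := by
    intro i q
    obtain ⟨χ, hχ⟩ := hK p (by omega) q
    rw [coeff_coeffMap, heisDeriv_pow_coeff]
    refine (hE i _).symm.trans ?_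
    rw [hχ]
    rcases i with _ | i
    · have h1 : vacCoeff (δ ((ser (hOdd ε s l)).coeff (p + q + 1))) =
          if p + q + 1 = 0 then -1 else 0 := by
        rw [coeff_ser]
        exact vacDeriv_gamma_beta_hOdd ε s hl _
      rw [if_pos rfl, pow_zero, Module.End.one_apply, map_add, map_add, h1]
      simp [δ]
    · have h1 : D ((ser (hOdd ε s l)).coeff (p + q + 1)) = 0 := by
        change (fockDeriv (.heis 0 0) (ser (hOdd ε s l))).coeff _ = 0
        rw [fockDeriv_heis_zero_hOdd ε s hl, HahnSeries.coeff_zero]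
      have h2 : D (χ • 1) = 0 := by simp [D]
      rw [if_neg (Nat.succ_ne_zero i), pow_succ, Module.End.mul_apply, map_add, h1, h2, add_zero,
        map_zero, map_zero, map_zero]
  have hne : coeffMap ζ (ser (Y + Z)) ≠ 0 := fun h => by
    have := hζ 0 (-p - 1)
    rw [pow_zero, Module.End.one_apply, h, if_pos rfl, if_pos (by ring)] at this
    simp at this
  have hpos : ∀ i, 0 < i → coeffMap ζ ((heisDeriv m ^ i) (ser (Y + Z))) = 0 := by
    intro i hi
    ext1
    funext q
    have := hζ i q
    rw [if_neg hi.ne'] at this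
    exact (mul_eq_zero.mp this).resolve_left (neg_ne_zero.mpr hε0)
  have hZ0 : ∀ i, coeffMap ζ ((heisDeriv m ^ i) (ser Z)) = 0 := by
    intro i
    let φ : QField (Fock m) →ₗ[ℂ] LaurentSeries ℂ := coeffMap ζ ∘ₗ (heisDeriv m ^ i) ∘ₗ ser
    have : Z ∈ LinearMap.ker φ := by
      refine Submodule.span_le.mpr ?_ hZ
      rintro _ ⟨L, hL, rfl⟩
      change coeffMap ζ ((heisDeriv m ^ i) (ser (nord ε L _))) = 0
      rw [ser_nord, ser_oneField, mul_one]
      have hw := ((((hasWeight_creProd ε L).heisDeriv_pow i).fockDeriv (.beta l 0)).fockDeriv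
        (.gamma 0 0)).fockDeriv (.gamma 0 (-p - 2).toNat)
      refine hw.vacCoeff_eq_zero ?_
      have := weight_ne_of_charge hε hL.2
      simp only [oscWeight, if_neg hl, if_true]
      omega
    exact this
  -- The twist `t` is the coefficient of b^(0)_(-1) w in the creation part of -αφ(w), so this power
  -- annihilates Y; Z is already invisible to `ζ`, and the nonzero monomial is left with no source.
  obtain ⟨T, hT⟩ := exists_pow_eq_zero_of_mem_span (twistedDeriv m t) _ (by
    rintro _ ⟨L, -, rfl⟩
    refine ⟨L.length + 1, ?_⟩
    dsimp only
    rw [ser_nord, ser_vertexExp, twistedDeriv_pow_mul_expCreSer, heisDeriv_pow_creProd, zero_mul])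
      hY
  have h1 := coeffMap_twistedDeriv t ζ (ser (Y + Z)) hpos T
  have h2 := coeffMap_twistedDeriv t ζ (ser Z) (fun i _ => hZ0 i) T
  have h3 : coeffMap ζ (ser Z) = 0 := by simpa using hZ0 0
  rw [map_add, map_add, hT T le_rfl, zero_add, h2, h3, mul_zero, ← map_add ser] at h1
  refine mul_ne_zero (pow_ne_zero _ (neg_ne_zero.mpr (smul_ne_zero ?_ ?_))) hne h1.symm
  · exact mul_ne_zero (neg_ne_zero.mpr (inv_ne_zero hs)) hκ
  · exact single_ne_zero one_ne_zero

end Charge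

end Superelliptic

end

/-! ### Assembly of the six statements. -/

theorem mainTheorem1 (m r : ℕ) [NeZero m] (hm : 2 ≤ m) (hr : 2 ≤ r) (c : ℂ)
    (k s : ℂ) (hk : k ≠ 0) (hs : s ^ 2 = k) (hk' : ∀ n : ℤ, 1 / k ≠ (n : ℂ))
    (ε : ℂ) (hε : ε = 1 ∨ ε = -1)
    (κ : ℂ) (hκ : κ = 1 / 2 ∨ 2 * κ ^ 2 = 1 ∨ 2 * κ ^ 2 = -1) :
    (∀ l : Fin m, l ≠ 0 → ¬ HasResidue (eEven m ε) (fOdd ε κ s l) (hOdd ε s l)) ∧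
    (∀ l₁ l₂ : Fin m, l₁ ≠ 0 → l₂ ≠ 0 → ¬ IsLaurentOPE (eOdd ε κ s l₁) (fOdd ε κ s l₂)) ∧
    (∀ l l' : Fin m, l ≠ 0 → (l : ℕ) + (l' : ℕ) = m →
      ¬ IsLaurentOPE (eOdd ε κ s l) (fOdd ε κ s l')) ∧
    (∀ (l : Fin m) (F : QField (Fock m)), l ≠ 0 →
      IsWakimotoLowering ε κ s⁻¹ l (fun L => charge ε L = 0 ∨ charge ε L = -2) F →
      ¬ RealizesBracket r c ε s 0 l (eEven m ε) F) ∧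
    (∀ (l : Fin m) (E : QField (Fock m)), l ≠ 0 → IsWakimotoRaising ε κ s⁻¹ l E →
      ¬ RealizesBracket r c ε s l 0 E (fEven m ε s)) ∧
    (∀ (l₁ l₂ : Fin m) (E F : QField (Fock m)), l₁ ≠ 0 → l₂ ≠ 0 →
      IsWakimotoRaising ε κ s⁻¹ l₁ E → IsWakimotoLowering ε κ s⁻¹ l₂ (fun _ => True) F →
      ¬ RealizesBracket r c ε s l₁ l₂ E F) := by
  have hs0 : s ≠ 0 := fun h => hk (by rw [← hs, h]; norm_num)
  have hκ0 : κ ≠ 0 := fun h => by rcases hκ with h' | h' | h' <;> norm_num [h] at h'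
  -- The exponent equals 2κ²/k, that is 1/(2k), 1/k or -1/k in the three normalisations. If it were
  -- an integer, so would be 1/k.
  have hθ : ∀ n : ℤ, -(2 * s⁻¹ * (-s⁻¹) * κ ^ 2) ≠ (n : ℂ) := by
    intro n hn
    have h1 : 2 * κ ^ 2 * (1 / k) = n := by
      rw [← hn, ← hs]
      field_simp
    rcases hκ with rfl | h | h
    · refine hk' (2 * n) ?_
      push_cast
      linear_combination 2 * h1
    · exact hk' n (by linear_combination h1 - (1 / k) * h)
    · refine hk' (-n) ?_
      push_cast
      linear_combination -h1 + (1 / k) * h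
  have hr0 : r ≠ 0 := by omega
  refine ⟨fun l hl => not_hasResidue_eEven_fOdd ε κ s hl,
    fun l₁ l₂ h₁ h₂ => not_isLaurentOPE_eOdd_fOdd ε κ s hs0 hθ h₁ h₂,
    fun l l' hl hll => not_isLaurentOPE_eOdd_fOdd ε κ s hs0 hθ hl fun h => ?_,
    fun l F hl hF => not_realizesBracket_eEven hs0 hκ0 hε hl hF,
    fun l E hl hE => not_realizesBracket_fEven hs0 hl hE, fun l₁ l₂ E F h₁ h₂ hE hF => ?_⟩
  -- Part (C) is the case l' = m - l of (B): l' = 0 would force l = m.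
  · have := l.isLt
    rw [h, Fin.val_zero] at hll
    omega
  · by_cases h : (l₁ : ℕ) + l₂ = m
    · exact not_realizesBracket_of_add_eq hr0 hs0 hκ0 hθ h₁ h hE hF
    · exact not_realizesBracket_of_ne_zero hr0 h₁ h₂ h hE hF
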